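/- All graphs are finite and simple. The direct product $G\times H$ has vertex set $V(G)\times V(H)$, and $(x_1,y_1)$, $(x_2,y_2)$ are adjacent iff $x_1x_2\in E(G)$ and $y_1y_2\in E(H)$. An edge-cut of a graph $\Gamma$ is a set $S\subseteq E(\Gamma)$ such that $\Gamma-S$ is not connected; it is minimum if no edge-cut has fewer edges. A bipartition $\{C,D\}$ of a graph is a partition of its vertex set (a part may be empty) such that every edge joins $C$ to $D$. **Theorem 1.2.** Let neither $G$ nor $H$ be isomorphic to the path $P_3$ on three vertices or to the 4-cycle $C_4$, and let $S$ be a minimum edge-cut in $G\times H$. Then there is a partition of $V(G\times H)$ into two nonempty sets $B$ (black) and $W$ (white) such that $S$ is the set of all edges of $G\times H$ between $B$ and $W$; if $G\times H$ has at most two connected components (in particular if it is connected), then $B$ and $W$ are exactly the connected components of $(G\times H)-S$ (which are then two in number); and at least one of the following holds. 1. $B=B'\times V(H)$ and $W=W'\times V(H)$, where $B'\cup W'=V(G)$. 2. $B=V(G)\times B'$ and $W=V(G)\times W'$, where $B'\cup W'=V(H)$. 3. $|B|=1$ or $|W|=1$. 4. $B=(A_1\times C)\cup(A_2\times D)$ and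 $W=(A_1\times D)\cup(A_2\times C)$ for a partition $V(G)=A_1\cup A_2$ and a partition $V(H)=C\cup D$, where $\{A_1,A_2\}$ is a bipartition of $G$ or $\{C,D\}$ is a bipartition of $H$. 5. $H$ has a bipartition $\{C,D\}$ and there is a partition $V(G)=A_1\cup A_2\cup A_3$ with $A_1\cup A_2\neq\emptyset$ and $A_3\ne\emptyset$ such that one of the sets $B,W$ is $(A_1\times C)\cup(A_2\times D)$ and the other is $(A_1\times D)\cup(A_2\times C)\cup(A_3\times V(H))$. 6. The same as 5 with the two factors exchanged: $G$ has a bipartition $\{C,D\}$ and there is a partition $V(H)=A_1\cup A_2\cup A_3$ with $A_1\cup A_2\neq\emptyset$ and $A_3\neq\emptyset$ such that one of $B,W$ is $(C\times A_1)\cup(D\times A_2)$ and the other is $(D\times A_1)\cup(C\times A_2)\cup(V(G)\times A_3)$. 7. $H$ has a bipartition $\{C,D\}$ and there is a partition $V(G)=A_1\cup A_2\cup A_3\cup A_4$ with $A_1\cup A_2$, $A_3$, $A_4$ nonempty such that $B=(A_1\times C)\cup(A_2\times D)\cup(A_3\times V(H))$ and $W=(A_1\times D)\cup(A_2\times C)\cup(A_4\times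 V(H))$. 8. The same as 7 with the two factors exchanged: $G$ has a bipartition $\{C,D\}$ and there is a partition $V(H)=A_1\cup A_2\cup A_3\cup A_4$ with $A_1\cup A_2$, $A_3$, $A_4$ nonempty such that $B=(C\times A_1)\cup(D\times A_2)\cup(V(G)\times A_3)$ and $W=(D\times A_1)\cup(C\times A_2)\cup(V(G)\times A_4)$. In all partitions, parts not required to be nonempty may be empty. -/

import Mathlib

namespace DirectProductCuts

/-- The direct (tensor, Kronecker) product `G × H` of two simple graphs: `(x₁, y₁)` and `(x₂, y₂)`
are adjacent iff `x₁ x₂ ∈ E(G)` and `y₁ y₂ ∈ E(H)`. -/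
def directProd {α β : Type*} (G : SimpleGraph α) (H : SimpleGraph β) : SimpleGraph (α × β) where
  Adj p q := G.Adj p.1 q.1 ∧ H.Adj p.2 q.2
  symm := ⟨fun _ _ h => ⟨h.1.symm, h.2.symm⟩⟩
  loopless := ⟨fun _ h => h.1.ne rfl⟩

/-- `S ⊆ E(Γ)` is an edge-cut of `Γ` if `Γ - S` is not connected. (`Preconnected` is used, so the
graph without vertices has no edge-cut.) -/
def IsEdgeCut {V : Type*} (Γ : SimpleGraph V) (S : Set (Sym2 V)) : Prop :=
  S ⊆ Γ.edgeSet ∧ ¬ (Γ.deleteEdges S).Preconnected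

/-- A minimum edge-cut: an edge-cut with the smallest number of edges. It is used for finite
graphs only. -/
def IsMinEdgeCut {V : Type*} (Γ : SimpleGraph V) (S : Set (Sym2 V)) : Prop :=
  IsEdgeCut Γ S ∧ ∀ T : Set (Sym2 V), IsEdgeCut Γ T → S.ncard ≤ T.ncard

/-- `B` (black) and `W` (white) are nonempty and partition the vertex set, and `S` is the set of
all edges of `Γ` with one endvertex in `B` and the other in `W`. -/
def IsBlackWhite {V : Type*} (Γ : SimpleGraph V) (S : Set (Sym2 V)) (B W : Set V) : Prop :=
  B.Nonempty ∧ W.Nonempty ∧ IsCompl B W ∧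
    S = {e | ∃ b ∈ B, ∃ w ∈ W, Γ.Adj b w ∧ e = s(b, w)}

/-- `Γ` has exactly two connected components, and their vertex sets are `B` and `W`. -/
def AreTheComponents {V : Type*} (Γ : SimpleGraph V) (B W : Set V) : Prop :=
  B ≠ W ∧ Set.range (fun c : Γ.ConnectedComponent => c.supp) = {B, W}

/-- `C ∪ D` is a bipartition of the graph `H`: `C` and `D` partition the vertex set, and
`E(H) = [C, D]`. One of the two parts may be empty. -/
def IsBipartition {β : Type*} (H : SimpleGraph β) (C D : Set β) : Prop :=
  IsCompl C D ∧ H.IsBipartiteWith C D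

/-- The sets `A i` are pairwise disjoint and cover `α`; some of them may be empty. -/
def IsPartitionInto {α : Type*} {n : ℕ} (A : Fin n → Set α) : Prop :=
  Pairwise (fun i j => Disjoint (A i) (A j)) ∧ (⋃ i, A i) = Set.univ

section Types

variable {α β : Type*}

/-- Type 1: every `H`-layer is monochromatic. -/
def Type1 (B W : Set (α × β)) : Prop :=
  ∃ B' W' : Set α, B' ∪ W' = Set.univ ∧ B = B' ×ˢ Set.univ ∧ W = W' ×ˢ Set.univ

/-- Type 2: every `G`-layer is monochromatic. -/
def Type2 (B W : Set (α × β)) : Prop :=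
  ∃ B' W' : Set β, B' ∪ W' = Set.univ ∧ B = Set.univ ×ˢ B' ∧ W = Set.univ ×ˢ W'

/-- Type 3: one of the two sides is a single vertex. -/
def Type3 (B W : Set (α × β)) : Prop :=
  B.ncard = 1 ∨ W.ncard = 1

/-- Type 4: a checkerboard of a partition of `V(G)` and a partition of `V(H)`, at least one of
which is a bipartition of the graph. -/
def Type4 (G : SimpleGraph α) (H : SimpleGraph β) (B W : Set (α × β)) : Prop :=
  ∃ (A₁ A₂ : Set α) (C D : Set β), IsCompl A₁ A₂ ∧ IsCompl C D ∧
    (IsBipartition G A₁ A₂ ∨ IsBipartition H C D) ∧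
    B = A₁ ×ˢ C ∪ A₂ ×ˢ D ∧ W = A₁ ×ˢ D ∪ A₂ ×ˢ C

/-- Type 5: `H` is bipartite, every `H`-layer is either coloured along its bipartition or
monochromatic, and the monochromatic `H`-layers exist and have the same colour. -/
def Type5 (H : SimpleGraph β) (B W : Set (α × β)) : Prop :=
  ∃ (A : Fin 3 → Set α) (C D : Set β), IsPartitionInto A ∧ IsBipartition H C D ∧
    (A 0 ∪ A 1).Nonempty ∧ (A 2).Nonempty ∧
    ((B = A 0 ×ˢ C ∪ A 1 ×ˢ D ∧ W = A 0 ×ˢ D ∪ A 1 ×ˢ C ∪ A 2 ×ˢ Set.univ) ∨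
     (W = A 0 ×ˢ C ∪ A 1 ×ˢ D ∧ B = A 0 ×ˢ D ∪ A 1 ×ˢ C ∪ A 2 ×ˢ Set.univ))

/-- Type 6: type 5 with the roles of `G` and `H` exchanged. -/
def Type6 (G : SimpleGraph α) (B W : Set (α × β)) : Prop :=
  ∃ (A : Fin 3 → Set β) (C D : Set α), IsPartitionInto A ∧ IsBipartition G C D ∧
    (A 0 ∪ A 1).Nonempty ∧ (A 2).Nonempty ∧
    ((B = C ×ˢ A 0 ∪ D ×ˢ A 1 ∧ W = D ×ˢ A 0 ∪ C ×ˢ A 1 ∪ Set.univ ×ˢ A 2) ∨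
     (W = C ×ˢ A 0 ∪ D ×ˢ A 1 ∧ B = D ×ˢ A 0 ∪ C ×ˢ A 1 ∪ Set.univ ×ˢ A 2))

/-- Type 7: `H` is bipartite, every `H`-layer is either coloured along its bipartition (this
happens at least once) or monochromatic, and there are both black and white `H`-layers. -/
def Type7 (H : SimpleGraph β) (B W : Set (α × β)) : Prop :=
  ∃ (A : Fin 4 → Set α) (C D : Set β), IsPartitionInto A ∧ IsBipartition H C D ∧
    (A 0 ∪ A 1).Nonempty ∧ (A 2).Nonempty ∧ (A 3).Nonempty ∧
    B = A 0 ×ˢ C ∪ A 1 ×ˢ D ∪ A 2 ×ˢ Set.univ ∧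
    W = A 0 ×ˢ D ∪ A 1 ×ˢ C ∪ A 3 ×ˢ Set.univ

/-- Type 8: type 7 with the roles of `G` and `H` exchanged. -/
def Type8 (G : SimpleGraph α) (B W : Set (α × β)) : Prop :=
  ∃ (A : Fin 4 → Set β) (C D : Set α), IsPartitionInto A ∧ IsBipartition G C D ∧
    (A 0 ∪ A 1).Nonempty ∧ (A 2).Nonempty ∧ (A 3).Nonempty ∧
    B = C ×ˢ A 0 ∪ D ×ˢ A 1 ∪ Set.univ ×ˢ A 2 ∧
    W = D ×ˢ A 0 ∪ C ×ˢ A 1 ∪ Set.univ ×ˢ A 3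

end Types

end DirectProductCuts

/-!
A cut of `G × H` is a colouring `f : α → β → Bool` (`true` is black), and the layer over `g` is
`f g : β → Bool`. For colourings `a`, `b` of `H` let `disagree H a b` be the number of ordered
adjacent pairs `(h, h')` with `a h ≠ b h'`; summing it over the ordered edges `(g, g')` of `G`, with
`a = f g` and `b = f g'`, counts every edge of the cut twice (`total`). Let `dG`, `dH` be the
minimum degrees. As isolating a vertex is an edge-cut, a minimum one has at most `dG * dH` edges.

The layer over `g` is *good* (`NbhdConst`) if it is constant on every neighbourhood. For connected
`H` that means that it is constant or a proper colouring, so if all `H`-layers are good the cut has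
type 1, 4, 5 or 7 (`type_of_nbhdConst`), and if all `G`-layers are good it has type 2, 4, 6 or 8.
It remains to see that in a cut with a bad `H`-layer, a bad `G`-layer and at most `dG * dH` edges
the change of colour of a single vertex removes all cut edges (`layers_nbhdConst_or_exists_flip`).

Call an edge `g g'` of `G` light if `f g` is bad and `disagree H (f g) (f g') < dH`. Two facts drive
the counting. A nonempty set of vertices on one side of `K₂ × H` that has fewer than `dH` edges in
its cut has at least `dH` elements (`le_card_of_disagree_lt`), and adding (mod 2) a pair of
colourings without disagreement does not change `disagree` (`disagree_xor`). So a light edge at `g`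
makes `f g` expensive next to every good layer, at least `dH ^ 2`, which forces all `H`-layers to be
bad (`not_nbhdConst_of_light`). If both factors have light edges, then there are at least `2 * dH`
vertices in `H` and `2 * dG` in `G`, the cut has at least `dG ^ 2` and at least `dH ^ 2` edges,
everything is an equality, and a parity count in a regular graph gives a contradiction
(`false_of_light_of_light`).

If `G`, say, has no light edge, a single bad layer `f g` uses up the whole budget `dG * dH`
(`exists_flip_of_heavy`). Hence all the cut edges meet the layer over `g`, its neighbouring layers
are good (unless `G` is a single edge, when all `G`-layers are good), and `f g`
differs in exactly one vertex from what each of them prescribes. If that vertex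
is always the same, changing its colour removes all cut edges, so for connected `G × H` the cut
isolates a vertex. Otherwise two good colourings of `H` differ exactly in two vertices of degree
`dH`, and this happens only in `P₃`, in `C₄` and in graphs on two vertices, where every colouring
is good (`path_or_cycle_of_nbhdConst_pair`).
-/

namespace DirectProductCuts

/-! ### Colourings that are constant on neighbourhoods -/

section Counting
open scoped Classical
open Finset

variable {α β : Type*}

/-- The colouring `a` is constant on the neighbourhood of every vertex. It is expressed by a
colouring `b` that has no disagreement with `a`: the value `b h'` is the colour of all neighbours
of `h'`. -/
def NbhdConst (H : SimpleGraph β) (a : β → Bool) : Prop :=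
  ∃ b : β → Bool, ∀ ⦃h h'⦄, H.Adj h h' → a h = b h'

lemma NbhdConst.eq {H : SimpleGraph β} {a : β → Bool} (ha : NbhdConst H a) {x h h' : β}
    (h₁ : H.Adj h x) (h₂ : H.Adj h' x) : a h = a h' := by
  obtain ⟨b, hb⟩ := ha
  rw [hb h₁, hb h₂]

lemma NbhdConst.const_or_proper {H : SimpleGraph β} (hH : H.Preconnected) {a : β → Bool}
    (ha : NbhdConst H a) :
    (∀ h h', a h = a h') ∨ (∀ h h', H.Adj h h' → a h ≠ a h') := by
  by_cases hp : ∀ h h', H.Adj h h' → a h ≠ a h'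
  · exact Or.inr hp
  push Not at hp
  obtain ⟨u, v, huv, he⟩ := hp
  have key : ∀ x, a x = a u ∧ ∀ y, H.Adj x y → a y = a u := by
    intro x
    obtain ⟨p⟩ := hH x u
    induction p with
    | nil => exact ⟨rfl, fun y hy => (ha.eq hy.symm huv.symm).trans he.symm⟩
    | @cons x y _ hxy _ ih =>
      obtain ⟨h1, h2⟩ := ih huv he
      refine ⟨h2 _ hxy.symm, fun z hz => ?_⟩
      have := ha.eq hz.symm hxy.symm
      rw [this, h1]
  exact Or.inl fun h h' => (key h).1.trans (key h').1.symm

/-- A function that takes equal values at adjacent vertices of a connected graph is constant. -/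
lemma eq_of_adj_eq {H : SimpleGraph β} (hH : H.Preconnected) {γ : Type*} {a : β → γ}
    (ha : ∀ h h', H.Adj h h' → a h = a h') (h h' : β) : a h = a h' := by
  obtain ⟨p⟩ := hH h h'
  induction p with
  | nil => rfl
  | cons hxy _ ih => exact (ha _ _ hxy).trans ih

/-! ### Recognizing `P₃` and `C₄` -/

lemma nonempty_iso_pathGraph_three {H : SimpleGraph β} {u x v : β} (huv : u ≠ v)
    (hux : H.Adj u x) (hvx : H.Adj v x) (hn : ¬ H.Adj u v)
    (hall : ∀ y, y = u ∨ y = x ∨ y = v) : Nonempty (H ≃g SimpleGraph.pathGraph 3) := by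
  have hb : Function.Bijective ![u, x, v] := by
    constructor
    · have := hux.ne
      have := hvx.ne
      intro i j hij
      fin_cases i <;> fin_cases j <;> simp_all
    · intro y
      rcases hall y with rfl | rfl | rfl
      exacts [⟨0, rfl⟩, ⟨1, rfl⟩, ⟨2, rfl⟩]
  refine ⟨(show SimpleGraph.pathGraph 3 ≃g H from ⟨Equiv.ofBijective _ hb, ?_⟩).symm⟩
  intro i j
  have h1 := hux.symm
  have h2 := hvx.symm
  have h3 : ¬ H.Adj v u := fun h => hn h.symm
  fin_cases i <;> fin_cases j <;> simp [SimpleGraph.pathGraph_adj, *]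

lemma nonempty_iso_cycleGraph_four {H : SimpleGraph β} {u x v y : β} (huv : u ≠ v) (hxy : x ≠ y)
    (hux : H.Adj u x) (hvx : H.Adj v x) (huy : H.Adj u y) (hvy : H.Adj v y)
    (hn : ¬ H.Adj u v) (hn' : ¬ H.Adj x y)
    (hall : ∀ z, z = u ∨ z = x ∨ z = v ∨ z = y) :
    Nonempty (H ≃g SimpleGraph.cycleGraph 4) := by
  have hb : Function.Bijective ![u, x, v, y] := by
    constructor
    · have := hux.ne
      have := hvx.ne
      have := huy.ne
      have := hvy.ne
      intro i j hij
      fin_cases i <;> fin_cases j <;> simp_all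
    · intro y
      rcases hall y with rfl | rfl | rfl | rfl
      exacts [⟨0, rfl⟩, ⟨1, rfl⟩, ⟨2, rfl⟩, ⟨3, rfl⟩]
  refine ⟨(show SimpleGraph.cycleGraph 4 ≃g H from ⟨Equiv.ofBijective _ hb, ?_⟩).symm⟩
  intro i j
  have h1 := hux.symm
  have h2 := hvx.symm
  have h3 := huy.symm
  have h4 := hvy.symm
  have h5 : ¬ H.Adj v u := fun h => hn h.symm
  have h6 : ¬ H.Adj y x := fun h => hn' h.symm
  fin_cases i <;> fin_cases j <;> simp [*] <;> decide

lemma nbhdConst_of_two_points {H : SimpleGraph β} {u v : β} (hall : ∀ x, x = u ∨ x = v)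
    (a : β → Bool) : NbhdConst H a := by
  refine ⟨fun h => if h = u then a v else a u, fun h h' hh => ?_⟩
  have hne := hh.ne
  rcases hall h with rfl | rfl <;> rcases hall h' with rfl | rfl <;> simp_all

/-! ### Counting disagreements of two colourings -/

variable [Fintype α] [Fintype β]

/-- The number of ordered pairs of adjacent vertices `h`, `h'` with `a h ≠ b h'`, that is, the
number of cut edges when the two layers of `K₂ × H` are coloured by `a` and `b`. -/
noncomputable def disagree (H : SimpleGraph β) (a b : β → Bool) : ℕ :=
  ∑ h, ∑ h', if H.Adj h h' ∧ a h ≠ b h' then 1 else 0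

lemma disagree_comm (H : SimpleGraph β) (a b : β → Bool) : disagree H a b = disagree H b a := by
  unfold disagree
  rw [sum_comm]
  refine sum_congr rfl fun h _ => sum_congr rfl fun h' _ => ?_
  simp only [H.adj_comm h h', ne_comm]

lemma disagree_eq_zero {H : SimpleGraph β} {a b : β → Bool} :
    disagree H a b = 0 ↔ ∀ h h', H.Adj h h' → a h = b h' := by
  simp [disagree]

/-- Adding a pair of colourings without disagreement preserves the number of disagreements. This
reduces comparisons with a good layer to comparisons with the constant colouring `false`. -/
lemma disagree_xor {H : SimpleGraph β} (a b : β → Bool) {s t : β → Bool}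
    (hst : ∀ h h', H.Adj h h' → s h = t h') :
    disagree H (fun h => a h ^^ s h) (fun h => b h ^^ t h) = disagree H a b := by
  unfold disagree
  refine sum_congr rfl fun h _ => sum_congr rfl fun h' _ => ?_
  by_cases hh : H.Adj h h'
  · simp [hst h h' hh]
  · simp [hh]

lemma sum_card_filter_neighborFinset (H : SimpleGraph β) (P Q : β → Prop)
    [DecidablePred P] [DecidablePred Q] :
    ∑ h with P h, #{h' ∈ H.neighborFinset h | Q h'} =
      ∑ h, ∑ h', if H.Adj h h' ∧ P h ∧ Q h' then 1 else 0 := by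
  rw [sum_filter]
  refine sum_congr rfl fun h _ => ?_
  rw [← card_filter]
  split_ifs with hh
  · congr 1
    ext; simp [hh]
  · simp [hh]

/-- Both sides count the ordered pairs of adjacent vertices the first of which satisfies `P` and the
second `Q`. -/
lemma sum_card_filter_neighborFinset_comm (H : SimpleGraph β) (P Q : β → Prop)
    [DecidablePred P] [DecidablePred Q] :
    ∑ h with P h, #{h' ∈ H.neighborFinset h | Q h'} =
      ∑ h with Q h, #{h' ∈ H.neighborFinset h | P h'} := by
  rw [sum_card_filter_neighborFinset, sum_card_filter_neighborFinset, sum_comm]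
  refine sum_congr rfl fun h _ => sum_congr rfl fun h' _ => ?_
  simp only [H.adj_comm h h', and_comm (a := P h')]

lemma disagree_eq_add (H : SimpleGraph β) (a b : β → Bool) :
    disagree H a b =
      ∑ h with a h = true, #{h' ∈ H.neighborFinset h | b h' = false} +
      ∑ h with b h = true, #{h' ∈ H.neighborFinset h | a h' = false} := by
  rw [sum_card_filter_neighborFinset_comm H (fun h => b h = true),
    sum_card_filter_neighborFinset, sum_card_filter_neighborFinset, ← sum_add_distrib, disagree]
  refine sum_congr rfl fun h _ => ?_
  rw [← sum_add_distrib]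
  refine sum_congr rfl fun h' _ => ?_
  cases a h <;> cases b h' <;> simp

lemma disagree_false (H : SimpleGraph β) (a : β → Bool) :
    disagree H a (fun _ => false) = ∑ h with a h = true, H.degree h := by
  simp [disagree_eq_add]

/-- A cut of `K₂ × H` with fewer than `d` edges has at least `d` black vertices in a layer if it has
one there. -/
lemma le_card_of_disagree_lt {H : SimpleGraph β} {d : ℕ} (hd : ∀ h, d ≤ H.degree h)
    {x y : β → Bool} (hxy : disagree H x y < d) (hx : ∃ h, x h = true) :
    d ≤ #{h | x h = true} := by
  by_contra! hlt
  -- a vertex has at most as many black neighbours as there are black vertices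
  have bound : ∀ (z : β → Bool) (h : β),
      d - #{h | z h = true} ≤ #{h' ∈ H.neighborFinset h | z h' = false} := by
    intro z h
    have h1 := card_filter_add_card_filter_not (s := H.neighborFinset h) (fun h' => z h' = true)
    have h2 : #{h' ∈ H.neighborFinset h | z h' = true} ≤ #{h | z h = true} :=
      card_le_card (filter_subset_filter _ (subset_univ _))
    have h3 := hd h
    rw [← SimpleGraph.card_neighborFinset_eq_degree] at h3
    simp only [Bool.not_eq_true] at h1
    omega
  have h1 := card_nsmul_le_sum {h | x h = true} _ _ fun h _ => bound y h
  have h2 := card_nsmul_le_sum {h | y h = true} _ _ fun h _ => bound x h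
  rw [disagree_eq_add] at hxy
  have h3 : 0 < #{h | x h = true} := by
    obtain ⟨h, hh⟩ := hx
    exact card_pos.2 ⟨h, by simpa using hh⟩
  simp only [smul_eq_mul] at h1 h2
  -- with `m` and `n` black vertices in the two layers, `1 ≤ m < d`, there are at least
  -- `m * (d - n) + n * (d - m) ≥ (d - n) + n` cut edges
  have h4 := Nat.le_mul_of_pos_left (d - #{h | y h = true}) h3
  have h5 := Nat.le_mul_of_pos_right #{h | y h = true} (Nat.sub_pos_of_lt hlt)
  omega

lemma two_mul_le_card_of_disagree_lt {H : SimpleGraph β} {d : ℕ} (hd : ∀ h, d ≤ H.degree h)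
    {a b : β → Bool} (ha : ¬ NbhdConst H a) (hab : disagree H a b < d) :
    2 * d ≤ Fintype.card β := by
  have h1 : ∃ h, a h = true := by
    by_contra! hn
    exact ha ⟨fun _ => false, fun h _ _ => by simpa using hn h⟩
  have h2 : ∃ h, (a h ^^ true) = true := by
    by_contra! hn
    exact ha ⟨fun _ => true, fun h _ _ => by simpa using hn h⟩
  have h3 := le_card_of_disagree_lt hd hab h1
  have h4 := le_card_of_disagree_lt hd
    (by rwa [disagree_xor a b (s := fun _ => true) (t := fun _ => true) (by simp)]) h2
  have h5 := card_filter_add_card_filter_not (s := (univ : Finset β)) (fun h => a h = true)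
  simp only [Bool.xor_true, Bool.not_eq_true', Bool.not_eq_true] at h4 h5
  rw [card_univ] at h5
  omega

lemma disagree_eq_sum_degree {H : SimpleGraph β} (a : β → Bool) {s t : β → Bool}
    (hts : ∀ h h', H.Adj h h' → t h = s h') :
    disagree H a s = ∑ h with a h ≠ t h, H.degree h := by
  rw [← disagree_xor a s hts]
  simp only [Bool.xor_self, disagree_false]
  congr 1
  ext h
  cases a h <;> cases t h <;> simp

/-- A bad colouring `a` with a light edge is far from every good colouring: relative to `s` at least
`d` vertices have the wrong colour, and each of them is in at least `d` cut edges. -/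
lemma mul_self_le_disagree {H : SimpleGraph β} {d : ℕ} (hd : ∀ h, d ≤ H.degree h)
    {a b s : β → Bool} (ha : ¬ NbhdConst H a) (hab : disagree H a b < d) (hs : NbhdConst H s) :
    d * d ≤ disagree H a s := by
  obtain ⟨t, ht⟩ := hs
  have hts : ∀ h h', H.Adj h h' → t h = s h' := fun h h' hh => (ht hh.symm).symm
  rw [disagree_eq_sum_degree a hts]
  have h1 : ∃ h, (a h ^^ t h) = true := by
    by_contra! hn
    exact ha ⟨s, fun h h' hh => by rw [← hts h h' hh]; simpa using hn h⟩
  have h2 := le_card_of_disagree_lt hd (by rwa [disagree_xor a b hts]) h1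
  have h3 : #{h | (a h ^^ t h) = true} = #{h | a h ≠ t h} := by
    congr 1
    ext h
    cases a h <;> cases t h <;> simp
  calc d * d ≤ #{h | a h ≠ t h} * d := Nat.mul_le_mul_right _ (h3 ▸ h2)
    _ ≤ _ := by simpa using card_nsmul_le_sum {h | a h ≠ t h} _ _ fun h _ => hd h

/-- In a `d`-regular graph the two kinds of disagreement (black in `a`, white in `b`, and
conversely) are equally frequent modulo `d`, so there cannot be just one disagreement. -/
lemma disagree_ne_one {H : SimpleGraph β} {d : ℕ} (hd : ∀ h, H.degree h = d) (h1 : 1 < d)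
    (a b : β → Bool) : disagree H a b ≠ 1 := by
  intro hab
  rw [disagree_eq_add] at hab
  have e : ∀ a b : β → Bool, ∑ h with a h = true, #{h' ∈ H.neighborFinset h | b h' = false} +
      ∑ h with a h = true, #{h' ∈ H.neighborFinset h | b h' = true} = #{h | a h = true} * d := by
    intro a b
    rw [← sum_add_distrib, ← smul_eq_mul, ← sum_const]
    refine sum_congr rfl fun h _ => ?_
    rw [← hd h, ← SimpleGraph.card_neighborFinset_eq_degree,
      ← card_filter_add_card_filter_not (s := H.neighborFinset h) (fun h' => b h' = false)]
    simp
  have s := sum_card_filter_neighborFinset_comm H (fun h => a h = true) (fun h => b h = true)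
  have ea := e a b
  have eb := e b a
  have hdvd : d ∣ 1 := by
    rcases Nat.add_eq_one_iff.1 hab with ⟨h0, h0'⟩ | ⟨h0, h0'⟩
    · exact (Nat.dvd_add_right (Dvd.intro_left _ ea.symm)).1
        (Dvd.intro_left _ (show #{h | b h = true} * d = _ by rw [← eb, ← s]; omega))
    · exact (Nat.dvd_add_right (Dvd.intro_left _ eb.symm)).1
        (Dvd.intro_left _ (show #{h | a h = true} * d = _ by rw [← ea, s]; omega))
  have := Nat.le_of_dvd one_pos hdvd
  omega

/-! ### The number of cut edges, layer by layer -/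

/-- The entries of a symmetric matrix summed by row and column `g` and the rest. -/
lemma sum_sum_eq_row (w : α → α → ℕ) (hw : ∀ x y, w x y = w y x) (g : α) (h0 : w g g = 0) :
    ∑ x, ∑ y, w x y = 2 * ∑ y, w g y + ∑ x ∈ univ.erase g, ∑ y ∈ univ.erase g, w x y := by
  rw [← add_sum_erase univ _ (mem_univ g)]
  have : ∀ x, ∑ y, w x y = w x g + ∑ y ∈ univ.erase g, w x y := fun x =>
    (add_sum_erase univ _ (mem_univ g)).symm
  rw [sum_congr rfl fun x _ => this x, sum_add_distrib, this g, h0,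
    sum_congr rfl fun x _ => hw x g]
  ring

/-- Twice the number of edges of `G × H` whose ends are coloured differently by `f`: the sum runs
over ordered edges of `G`. -/
noncomputable def total (G : SimpleGraph α) (H : SimpleGraph β) (f : α → β → Bool) : ℕ :=
  ∑ g, ∑ g', if G.Adj g g' then disagree H (f g) (f g') else 0

lemma total_eq_sum (G : SimpleGraph α) (H : SimpleGraph β) (f : α → β → Bool) :
    total G H f = ∑ p : α × α, ∑ q : β × β,
      if G.Adj p.1 p.2 ∧ H.Adj q.1 q.2 ∧ f p.1 q.1 ≠ f p.2 q.2 then 1 else 0 := by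
  simp only [Fintype.sum_prod_type, total, disagree]
  refine sum_congr rfl fun g _ => sum_congr rfl fun g' _ => ?_
  split_ifs with h <;> simp [h]

lemma total_swap (G : SimpleGraph α) (H : SimpleGraph β) (f : α → β → Bool) :
    total G H f = total H G (fun h g => f g h) := by
  rw [total_eq_sum, total_eq_sum, sum_comm]
  simp only [and_left_comm]

lemma total_eq_row (G : SimpleGraph α) (H : SimpleGraph β) (f : α → β → Bool) (g : α) :
    total G H f = 2 * ∑ g' ∈ G.neighborFinset g, disagree H (f g) (f g') +
      ∑ x ∈ univ.erase g, ∑ y ∈ univ.erase g,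
        if G.Adj x y then disagree H (f x) (f y) else 0 := by
  rw [total, sum_sum_eq_row _ _ g (by simp), ← sum_filter]
  · congr 4
    ext; simp
  · intro x y
    simp only [G.adj_comm x y, disagree_comm H (f x)]

lemma total_eq_sum_neighborFinset (G : SimpleGraph α) (H : SimpleGraph β) (f : α → β → Bool) :
    total G H f = ∑ g, ∑ g' ∈ G.neighborFinset g, disagree H (f g) (f g') := by
  rw [total]
  refine sum_congr rfl fun g _ => ?_
  rw [← sum_filter]
  congr 1
  ext; simp

/-! ### Light edges -/

lemma one_le_disagree {H : SimpleGraph β} {a : β → Bool} (ha : ¬ NbhdConst H a) (b : β → Bool) :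
    1 ≤ disagree H a b := by
  rw [Nat.one_le_iff_ne_zero]
  intro h
  exact ha ⟨b, fun h₁ h₂ => disagree_eq_zero.1 h h₁ h₂⟩

/-- If some edge `g₀ g₀'` is light, then no `H`-layer is good. -/
lemma not_nbhdConst_of_light {G : SimpleGraph α} {H : SimpleGraph β} (hG : G.Preconnected)
    {dG dH : ℕ} (hdG : ∀ g, dG ≤ G.degree g) (hdH : ∀ h, dH ≤ H.degree h) (hG1 : 1 ≤ dG)
    {f : α → β → Bool} (hT : total G H f ≤ 2 * (dG * dH)) {g₀ g₀' : α} (hadj : G.Adj g₀ g₀')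
    (h₀ : ¬ NbhdConst H (f g₀)) (hlt : disagree H (f g₀) (f g₀') < dH) (g : α) :
    ¬ NbhdConst H (f g) := by
  have hH2 : 2 ≤ dH := by have := one_le_disagree h₀ (f g₀'); omega
  -- a bad layer without a light edge uses up the whole budget, and `g₀ g₀'` exceeds it
  have light : ∀ g, ¬ NbhdConst H (f g) → ∃ g', G.Adj g g' ∧ disagree H (f g) (f g') < dH := by
    intro g hg
    by_contra! hheavy
    have hne : g₀ ≠ g := by
      rintro rfl
      exact absurd (hheavy _ hadj) (not_le.2 hlt)
    have hne' : g₀' ≠ g := by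
      rintro rfl
      have := hheavy _ hadj.symm
      rw [disagree_comm] at this
      omega
    have h1 : dG * dH ≤ ∑ g' ∈ G.neighborFinset g, disagree H (f g) (f g') := by
      calc dG * dH ≤ #(G.neighborFinset g) * dH :=
            Nat.mul_le_mul_right _ (by simpa using hdG g)
        _ ≤ _ := by
          simpa using card_nsmul_le_sum (G.neighborFinset g) _ dH
            fun g' hg' => hheavy g' (by simpa using hg')
    have h2 : 1 ≤ ∑ x ∈ univ.erase g, ∑ y ∈ univ.erase g,
        if G.Adj x y then disagree H (f x) (f y) else 0 := by
      calc 1 ≤ if G.Adj g₀ g₀' then disagree H (f g₀) (f g₀') else 0 := by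
            rw [if_pos hadj]; exact one_le_disagree h₀ _
        _ ≤ ∑ y ∈ univ.erase g, if G.Adj g₀ y then disagree H (f g₀) (f y) else 0 :=
            single_le_sum (f := fun y => if G.Adj g₀ y then disagree H (f g₀) (f y) else 0)
              (fun _ _ => Nat.zero_le _) (by simp [hne'])
        _ ≤ _ := single_le_sum (f := fun x => ∑ y ∈ univ.erase g,
              if G.Adj x y then disagree H (f x) (f y) else 0)
              (fun _ _ => Nat.zero_le _) (by simp [hne])
    have := total_eq_row G H f g
    omega
  have sq : ∀ g, ¬ NbhdConst H (f g) → ∀ g', NbhdConst H (f g') →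
      dH * dH ≤ disagree H (f g) (f g') := by
    intro g hg g' hg'
    obtain ⟨g'', -, h⟩ := light g hg
    exact mul_self_le_disagree hdH hg h hg'
  intro hg
  -- an edge of `G` between a bad and a good layer
  obtain ⟨x, y, hxy, hx, hy⟩ : ∃ x y, G.Adj x y ∧ ¬ NbhdConst H (f x) ∧ NbhdConst H (f y) := by
    by_contra! hno
    have := eq_of_adj_eq hG (a := fun g => NbhdConst H (f g)) (fun x y hxy => by
      refine propext ⟨fun h => ?_, fun h => ?_⟩
      · by_contra hc
        exact hno y x hxy.symm hc h
      · by_contra hc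
        exact hno x y hxy hc h) g₀ g
    exact h₀ (this ▸ hg)
  set N : Finset α := {g | ¬ NbhdConst H (f g)} with hN
  have row : ∀ g ∈ N, dG ≤ ∑ g' ∈ G.neighborFinset g, disagree H (f g) (f g') := by
    intro g hg
    have := card_nsmul_le_sum (G.neighborFinset g) _ 1
      fun g' _ => one_le_disagree (mem_filter.1 hg).2 (f g')
    simp only [SimpleGraph.card_neighborFinset_eq_degree, smul_eq_mul, mul_one] at this
    exact (hdG g).trans this
  have hxN : x ∈ N := by simp [hN, hx]
  have hyN : y ∈ univ \ N := by simp [hN, hy]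
  have hxy2 := sq x hx y hy
  have lower : ∑ g ∈ N, ∑ g' ∈ G.neighborFinset g, disagree H (f g) (f g') + dH * dH ≤
      total G H f := by
    rw [total_eq_sum_neighborFinset, ← sum_sdiff (subset_univ N), add_comm]
    gcongr
    calc dH * dH ≤ disagree H (f y) (f x) := by rwa [disagree_comm]
      _ ≤ ∑ g' ∈ G.neighborFinset y, disagree H (f y) (f g') :=
        single_le_sum (f := fun g' => disagree H (f y) (f g')) (fun _ _ => Nat.zero_le _)
          (by simpa using hxy.symm)
      _ ≤ _ := single_le_sum
        (f := fun g => ∑ g' ∈ G.neighborFinset g, disagree H (f g) (f g'))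
        (fun _ _ => Nat.zero_le _) hyN
  -- If there are few bad layers, each of them has many good neighbours, at a cost of `dH ^ 2` each.
  -- Otherwise the edges at bad layers are so numerous that already a cost of 1 for each of them and
  -- of `dH ^ 2` for `x y` is too much.
  by_cases hcard : #N ≤ dG
  · have row' : ∀ g ∈ N, (dG + 1 - #N) * (dH * dH) ≤
        ∑ g' ∈ G.neighborFinset g, disagree H (f g) (f g') := by
      intro g hg
      have h1 : dG + 1 - #N ≤ #(G.neighborFinset g \ N) := by
        have h2 : G.neighborFinset g ∩ N ⊆ N.erase g := by
          intro z hz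
          simp only [mem_inter, SimpleGraph.mem_neighborFinset] at hz
          exact mem_erase.2 ⟨hz.1.ne', hz.2⟩
        have h3 := card_le_card h2
        rw [card_erase_of_mem hg] at h3
        have h4 := card_sdiff_add_card_inter (G.neighborFinset g) N
        have h5 := hdG g
        rw [← SimpleGraph.card_neighborFinset_eq_degree] at h5
        have h6 := card_pos.2 ⟨g, hg⟩
        omega
      calc (dG + 1 - #N) * (dH * dH) ≤ #(G.neighborFinset g \ N) * (dH * dH) :=
            Nat.mul_le_mul_right _ h1
        _ ≤ ∑ g' ∈ G.neighborFinset g \ N, disagree H (f g) (f g') := by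
          simpa using card_nsmul_le_sum (G.neighborFinset g \ N) _ (dH * dH) fun g' hg' =>
            sq g (mem_filter.1 hg).2 g' (by simpa [hN] using (mem_sdiff.1 hg').2)
        _ ≤ _ := sum_le_sum_of_subset sdiff_subset
    have h1 := card_nsmul_le_sum N _ _ row'
    rw [smul_eq_mul] at h1
    have h2 : dG ≤ #N * (dG + 1 - #N) := by
      obtain ⟨k, hk⟩ := Nat.exists_eq_add_of_le hcard
      have h6 : 1 ≤ #N := card_pos.2 ⟨x, hxN⟩
      rw [show dG + 1 - #N = k + 1 by omega, hk]
      nlinarith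
    have h3 : dG * (dH * dH) ≤ #N * ((dG + 1 - #N) * (dH * dH)) := by
      rw [← mul_assoc #N]; exact Nat.mul_le_mul_right _ h2
    have h4 : 2 * (dG * dH) ≤ dG * (dH * dH) := by nlinarith [Nat.zero_le (dG * dH)]
    nlinarith
  · have h1 : dG - 1 + dH * dH ≤ ∑ g' ∈ G.neighborFinset x, disagree H (f x) (f g') := by
      have hmem : y ∈ G.neighborFinset x := by simpa using hxy
      rw [← sum_erase_add _ _ hmem]
      gcongr
      have h2 := card_nsmul_le_sum ((G.neighborFinset x).erase y) _ 1
        fun g' _ => one_le_disagree hx (f g')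
      rw [card_erase_of_mem hmem, SimpleGraph.card_neighborFinset_eq_degree, smul_eq_mul,
        mul_one] at h2
      have := hdG x
      omega
    have h2 := card_nsmul_le_sum (N.erase x) _ dG fun g hg => row g (mem_of_mem_erase hg)
    rw [card_erase_of_mem hxN, smul_eq_mul] at h2
    have h3 : dG * dG ≤ (#N - 1) * dG := Nat.mul_le_mul_right _ (by omega)
    rw [← sum_erase_add _ _ hxN] at lower
    zify [hG1] at *
    nlinarith [sq_nonneg ((dG : ℤ) - dH)]

lemma degree_le_sum_disagree {G : SimpleGraph α} {H : SimpleGraph β} {f : α → β → Bool} {g : α}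
    (hg : ¬ NbhdConst H (f g)) :
    G.degree g ≤ ∑ g' ∈ G.neighborFinset g, disagree H (f g) (f g') := by
  simpa using card_nsmul_le_sum (G.neighborFinset g) _ 1 fun g' _ => one_le_disagree hg (f g')

lemma two_mul_sq_le_total {G : SimpleGraph α} {H : SimpleGraph β} {d : ℕ}
    (hd : ∀ g, d ≤ G.degree g) {f : α → β → Bool} (hf : ∀ g, ¬ NbhdConst H (f g))
    (hcard : 2 * d ≤ Fintype.card α) : 2 * (d * d) ≤ total G H f := by
  have := card_nsmul_le_sum (univ : Finset α) _ d fun g _ =>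
    (hd g).trans (degree_le_sum_disagree (f := f) (hf g))
  rw [← total_eq_sum_neighborFinset, smul_eq_mul, card_univ] at this
  rw [← mul_assoc]
  exact (Nat.mul_le_mul_right d hcard).trans this

lemma sum_disagree_eq {G : SimpleGraph α} {H : SimpleGraph β} {d : ℕ}
    (hd : ∀ g, d ≤ G.degree g) {f : α → β → Bool} (hf : ∀ g, ¬ NbhdConst H (f g))
    (hcard : 2 * d ≤ Fintype.card α) (hT : total G H f ≤ 2 * (d * d)) (g : α) :
    ∑ g' ∈ G.neighborFinset g, disagree H (f g) (f g') = d := by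
  have h1 : ∀ g ∈ (univ : Finset α), d ≤ ∑ g' ∈ G.neighborFinset g, disagree H (f g) (f g') :=
    fun g _ => (hd g).trans (degree_le_sum_disagree (f := f) (hf g))
  refine ((sum_eq_sum_iff_of_le h1).1 (le_antisymm (sum_le_sum h1) ?_) g (mem_univ g)).symm
  rw [← total_eq_sum_neighborFinset, sum_const, card_univ, smul_eq_mul]
  rw [← mul_assoc] at hT
  exact hT.trans (Nat.mul_le_mul_right d hcard)

/-- Light edges in both factors are impossible: all layers are bad, so each ordered edge of `G` and
each ordered edge of `H` costs at least 1, while the factors have at least `2 * dG` and `2 * dH`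
vertices. -/
lemma false_of_light_of_light {G : SimpleGraph α} {H : SimpleGraph β} {dG dH : ℕ}
    (hdG : ∀ g, dG ≤ G.degree g) (hdH : ∀ h, dH ≤ H.degree h) (hG1 : 1 ≤ dG)
    {f : α → β → Bool} (hT : total G H f ≤ 2 * (dG * dH))
    (hfG : ∀ g, ¬ NbhdConst H (f g)) (hfH : ∀ h, ¬ NbhdConst G (fun g => f g h))
    (hα : 2 * dG ≤ Fintype.card α) (hβ : 2 * dH ≤ Fintype.card β)
    (hH2 : 2 ≤ dH) : False := by
  have h1 : dG * dG ≤ dG * dH := by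
    have := two_mul_sq_le_total hdG hfG hα
    omega
  have hswap := total_swap G H f
  have h2 : dH * dH ≤ dG * dH := by
    have := two_mul_sq_le_total hdH hfH hβ
    omega
  have h3 : dG ≤ dH := Nat.le_of_mul_le_mul_left h1 hG1
  have h4 : dH ≤ dG := Nat.le_of_mul_le_mul_right h2 (by omega)
  obtain rfl : dG = dH := le_antisymm h3 h4
  have row := sum_disagree_eq hdG hfG hα hT
  have row' := sum_disagree_eq hdH hfH hβ (hswap ▸ hT)
  have hreg : ∀ h, H.degree h = dG := fun h =>
    le_antisymm ((degree_le_sum_disagree (f := fun h g => f g h) (hfH h)).trans (row' h).le) (hdH h)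
  obtain ⟨g⟩ : Nonempty α := Fintype.card_pos_iff.1 (by omega)
  obtain ⟨g', hg'⟩ : (G.neighborFinset g).Nonempty := by
    rw [← card_pos, SimpleGraph.card_neighborFinset_eq_degree]
    exact hG1.trans (hdG g)
  have hone : ∀ g' ∈ G.neighborFinset g, 1 ≤ disagree H (f g) (f g') :=
    fun g' _ => one_le_disagree (hfG g) _
  have hsum : ∑ g' ∈ G.neighborFinset g, 1 =
      ∑ g' ∈ G.neighborFinset g, disagree H (f g) (f g') := by
    refine le_antisymm (sum_le_sum hone) ?_
    rw [row g]
    simpa using hdG g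
  have h5 := (sum_eq_sum_iff_of_le hone).1 hsum g' hg'
  exact disagree_ne_one hreg hH2 (f g) (f g') h5.symm

/-! ### Cuts without light edges -/

/-- The difference of two good colourings is good. If it is supported on two vertices of minimum
degree, the graph is very small. -/
lemma path_or_cycle_of_nbhdConst_pair {H : SimpleGraph β} (hH : H.Preconnected) {d : ℕ}
    (hd : ∀ h, d ≤ H.degree h) (hd1 : 1 ≤ d) {u v : β} (huv : u ≠ v)
    (hu : H.degree u = d) (hv : H.degree v = d)
    (ht : NbhdConst H (fun h => decide (h = u ∨ h = v))) :
    (∀ a, NbhdConst H a) ∨ Nonempty (H ≃g SimpleGraph.pathGraph 3) ∨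
      Nonempty (H ≃g SimpleGraph.cycleGraph 4) := by
  rcases ht.const_or_proper hH with hc | hp
  · refine Or.inl (nbhdConst_of_two_points (u := u) (v := v) fun x => ?_)
    simpa using hc x u
  right
  have hn : ¬ H.Adj u v := fun h => by simpa using hp _ _ h
  have hin : ∀ x y, H.Adj x y → x ≠ u → x ≠ v → y = u ∨ y = v := by
    intro x y hxy hxu hxv
    by_contra hno
    exact hp x y hxy (by simp [hxu, hxv, hno])
  have hout : ∀ x, H.Adj u x ∨ H.Adj v x → x ≠ u ∧ x ≠ v := by
    rintro x (h | h)
    · exact ⟨h.ne', by rintro rfl; exact hn h⟩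
    · exact ⟨by rintro rfl; exact hn h.symm, h.ne'⟩
  have hsub : ∀ x, x ≠ u → x ≠ v → H.neighborFinset x ⊆ {u, v} := by
    intro x hxu hxv y hy
    simpa using hin x y (by simpa using hy) hxu hxv
  rw [← SimpleGraph.card_neighborFinset_eq_degree] at hu hv
  obtain ⟨x, hx⟩ : (H.neighborFinset u).Nonempty := card_pos.1 (by omega)
  rw [SimpleGraph.mem_neighborFinset] at hx
  obtain ⟨hxu, hxv⟩ := hout x (Or.inl hx)
  have hd2 : d ≤ 2 := by
    refine (hd x).trans ?_
    rw [← SimpleGraph.card_neighborFinset_eq_degree]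
    exact (card_le_card (hsub x hxu hxv)).trans card_le_two
  obtain rfl | rfl : d = 1 ∨ d = 2 := by omega
  · left
    obtain ⟨x', hux⟩ := card_eq_one.1 hu
    obtain ⟨y, hvy⟩ := card_eq_one.1 hv
    simp only [Finset.ext_iff, SimpleGraph.mem_neighborFinset, mem_singleton] at hux hvy
    obtain rfl : x = x' := (hux x).1 hx
    have hxv' : H.Adj v x := by
      by_contra hno
      have := eq_of_adj_eq hH (a := fun z => z = u ∨ z = x) (fun p q hpq => ?_) u v
      · simp [huv.symm, hxv.symm] at this
      · have key : ∀ p q, H.Adj p q → (p = u ∨ p = x) → (q = u ∨ q = x) := by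
          rintro p q hpq (rfl | rfl)
          · exact Or.inr ((hux q).1 hpq)
          · rcases hin p q hpq hxu hxv with rfl | rfl
            · exact Or.inl rfl
            · exact absurd hpq.symm hno
        exact propext ⟨key p q hpq, key q p hpq.symm⟩
    refine nonempty_iso_pathGraph_three huv hx hxv' hn fun z => ?_
    have := eq_of_adj_eq hH (a := fun z => z = u ∨ z = x ∨ z = v) (fun p q hpq => ?_) u z
    · simpa using this
    · have key : ∀ p q, H.Adj p q → (p = u ∨ p = x ∨ p = v) → (q = u ∨ q = x ∨ q = v) := by
        rintro p q hpq (rfl | rfl | rfl)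
        · exact Or.inr (Or.inl ((hux q).1 hpq))
        · have := hin p q hpq hxu hxv; tauto
        · exact Or.inr (Or.inl (((hvy q).1 hpq).trans ((hvy x).1 hxv').symm))
      exact propext ⟨key p q hpq, key q p hpq.symm⟩
  · right
    have hboth : ∀ z, z ≠ u → z ≠ v → H.Adj u z ∧ H.Adj v z := by
      intro z hzu hzv
      have h1 := eq_of_subset_of_card_le (hsub z hzu hzv) (by
        rw [SimpleGraph.card_neighborFinset_eq_degree]; exact card_le_two.trans (hd z))
      simp only [Finset.ext_iff, SimpleGraph.mem_neighborFinset, mem_insert, mem_singleton] at h1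
      exact ⟨((h1 u).2 (Or.inl rfl)).symm, ((h1 v).2 (Or.inr rfl)).symm⟩
    obtain ⟨x, y, hxy, hN⟩ := card_eq_two.1 hu
    simp only [Finset.ext_iff, SimpleGraph.mem_neighborFinset, mem_insert, mem_singleton] at hN
    have hux := (hN x).2 (Or.inl rfl)
    have huy := (hN y).2 (Or.inr rfl)
    obtain ⟨hxu, hxv⟩ := hout x (Or.inl hux)
    obtain ⟨hyu, hyv⟩ := hout y (Or.inl huy)
    refine nonempty_iso_cycleGraph_four huv hxy hux (hboth x hxu hxv).2 huy (hboth y hyu hyv).2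
      hn (fun h => ?_) fun z => ?_
    · rcases hin x y h hxu hxv with h | h
      exacts [hyu h, hyv h]
    · by_cases hzu : z = u
      · exact Or.inl hzu
      by_cases hzv : z = v
      · simp [hzv]
      have := (hN z).1 (hboth z hzu hzv).1
      tauto

/-- If no edge of `G` is light, the cut edges at one bad layer already exhaust the bound on the
size, and changing the colour of a single vertex `(g, k)` leaves no cut edge. -/
lemma exists_flip_of_heavy {G : SimpleGraph α} {H : SimpleGraph β} (hG : G.Preconnected)
    (hH : H.Preconnected) (hHP : ¬ Nonempty (H ≃g SimpleGraph.pathGraph 3))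
    (hHC : ¬ Nonempty (H ≃g SimpleGraph.cycleGraph 4))
    {dG dH : ℕ} (hdG : ∀ g, dG ≤ G.degree g) (hdH : ∀ h, dH ≤ H.degree h) (hG1 : 1 ≤ dG)
    (hH1 : 1 ≤ dH) {f : α → β → Bool} (hT : total G H f ≤ 2 * (dG * dH))
    (hheavy : ∀ g g', G.Adj g g' → ¬ NbhdConst H (f g) → dH ≤ disagree H (f g) (f g'))
    {g : α} (hg : ¬ NbhdConst H (f g)) {h₀ : β} (hh₀ : ¬ NbhdConst G (fun g => f g h₀)) :
    ∃ k, ∀ x y, G.Adj x y → ∀ h h', H.Adj h h' →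
      (f x h ^^ decide (x = g ∧ h = k)) = (f y h' ^^ decide (y = g ∧ h' = k)) := by
  have hrow := total_eq_row G H f g
  have hle : ∀ g' ∈ G.neighborFinset g, dH ≤ disagree H (f g) (f g') :=
    fun g' hg' => hheavy g g' (by simpa using hg') hg
  have hsum : G.degree g * dH ≤ ∑ g' ∈ G.neighborFinset g, disagree H (f g) (f g') := by
    simpa using card_nsmul_le_sum (G.neighborFinset g) _ dH hle
  have hmul : dG * dH ≤ G.degree g * dH := Nat.mul_le_mul_right _ (hdG g)
  have hrest : ∑ x ∈ univ.erase g, ∑ y ∈ univ.erase g,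
      (if G.Adj x y then disagree H (f x) (f y) else 0) = 0 := by omega
  have hzero : ∀ x y, x ≠ g → y ≠ g → G.Adj x y → disagree H (f x) (f y) = 0 := by
    intro x y hx hy hxy
    have h1 := sum_eq_zero_iff.1 (sum_eq_zero_iff.1 hrest x (by simp [hx])) y (by simp [hy])
    rwa [if_pos hxy] at h1
  have hdeg : G.degree g = dG := Nat.eq_of_mul_eq_mul_right hH1 (by omega)
  have heq : ∀ g', G.Adj g g' → disagree H (f g) (f g') = dH := by
    intro g' hg'
    refine ((sum_eq_sum_iff_of_le hle).1 ?_ g' (by simpa using hg')).symm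
    rw [sum_const, SimpleGraph.card_neighborFinset_eq_degree, smul_eq_mul]
    omega
  -- a bad neighbour `g'` of `g` has no other neighbour than `g`; then `dG = 1`, so `G` is the edge
  -- `g g'`, and all `G`-layers are good
  have hgood : ∀ g', G.Adj g g' → NbhdConst H (f g') := by
    intro g' hgg'
    by_contra hg'
    have honly' : ∀ y, G.Adj g' y → y = g := by
      intro y hy
      by_contra hne
      have := one_le_disagree hg' (f y)
      have := hzero g' y hgg'.ne' hne hy
      omega
    have hdg' : G.degree g' ≤ 1 := by
      rw [← SimpleGraph.card_neighborFinset_eq_degree]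
      exact card_le_one.2 fun p hp q hq => by
        rw [honly' p (by simpa using hp), honly' q (by simpa using hq)]
    have hdg : #(G.neighborFinset g) ≤ 1 := by
      rw [SimpleGraph.card_neighborFinset_eq_degree, hdeg]
      exact (hdG g').trans hdg'
    have honly : ∀ y, G.Adj g y → y = g' := fun y hy =>
      card_le_one.1 hdg y (by simpa using hy) g' (by simpa using hgg')
    refine hh₀ (nbhdConst_of_two_points (u := g) (v := g') (fun x => ?_) _)
    have := eq_of_adj_eq hG (a := fun z => z = g ∨ z = g') (fun p q hpq => ?_) g x
    · simpa using this
    · have key : ∀ p q, G.Adj p q → (p = g ∨ p = g') → (q = g ∨ q = g') := by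
        rintro p q hpq (rfl | rfl)
        · exact Or.inr (honly q hpq)
        · exact Or.inl (honly' q hpq)
      exact propext ⟨key p q hpq, key q p hpq.symm⟩
  have hflip : ∀ g', G.Adj g g' → ∃ k, H.degree k = dH ∧
      ∀ h h', H.Adj h h' → (f g h ^^ decide (h = k)) = f g' h' := by
    intro g' hgg'
    obtain ⟨t, ht⟩ := hgood g' hgg'
    have hts : ∀ h h', H.Adj h h' → t h = f g' h' := fun h h' hh => (ht hh.symm).symm
    have hs := heq g' hgg'
    rw [disagree_eq_sum_degree _ hts] at hs
    have hc : #{h | f g h ≠ t h} = 1 := by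
      have h1 : #{h | f g h ≠ t h} * dH ≤ dH := by
        have := card_nsmul_le_sum {h | f g h ≠ t h} _ dH fun h _ => hdH h
        rwa [hs, smul_eq_mul] at this
      have h2 : #{h | f g h ≠ t h} ≠ 0 := by
        intro h0
        rw [card_eq_zero.1 h0, sum_empty] at hs
        omega
      have h3 : #{h | f g h ≠ t h} ≤ 1 := by by_contra!; nlinarith
      omega
    obtain ⟨k, hk⟩ := card_eq_one.1 hc
    rw [hk, sum_singleton] at hs
    refine ⟨k, hs, fun h h' hh => ?_⟩
    rw [← hts h h' hh]
    have := Finset.ext_iff.1 hk h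
    simp only [mem_filter, mem_univ, true_and, mem_singleton] at this
    by_cases hhk : h = k
    · have := this.2 hhk
      revert this
      cases f g h <;> cases t h <;> simp [hhk]
    · have := mt this.1 hhk
      revert this
      cases f g h <;> cases t h <;> simp [hhk]
  obtain ⟨g₁, hg₁⟩ : (G.neighborFinset g).Nonempty := by
    rw [← card_pos, SimpleGraph.card_neighborFinset_eq_degree]; omega
  rw [SimpleGraph.mem_neighborFinset] at hg₁
  obtain ⟨k, hkd, hk⟩ := hflip g₁ hg₁
  have hsame : ∀ g', G.Adj g g' → ∀ h h', H.Adj h h' →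
      (f g h ^^ decide (h = k)) = f g' h' := by
    intro g₂ hg₂
    obtain ⟨k', hkd', hk'⟩ := hflip g₂ hg₂
    obtain rfl | hne := eq_or_ne k k'
    · exact hk'
    exfalso
    have hpair : NbhdConst H (fun h => decide (h = k ∨ h = k')) := by
      refine ⟨fun h => f g₁ h ^^ f g₂ h, fun h h' hh => ?_⟩
      beta_reduce
      rw [← hk h h' hh, ← hk' h h' hh]
      by_cases h1 : h = k
      · have : h ≠ k' := by rw [h1]; exact hne
        simp [h1, hne]
      · by_cases h2 : h = k' <;> simp [h1, h2, hne.symm]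
    rcases path_or_cycle_of_nbhdConst_pair hH hdH hH1 hne hkd hkd' hpair with h | h | h
    exacts [hg (h _), hHP h, hHC h]
  refine ⟨k, fun x y hxy h h' hh => ?_⟩
  by_cases hx : x = g
  · subst hx
    simpa [hxy.ne'] using hsame y hxy h h' hh
  · by_cases hy : y = g
    · subst hy
      simpa [hx] using (hsame x hxy.symm h' h hh.symm).symm
    · simpa [hx, hy] using disagree_eq_zero.1 (hzero x y hx hy hxy) h h' hh

/-- In a cut with at most `dG * dH` edges all `H`-layers are good, or all `G`-layers are good, or
there is a vertex `(r, k)` whose change of colour removes all cut edges. -/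
theorem layers_nbhdConst_or_exists_flip {G : SimpleGraph α} {H : SimpleGraph β}
    (hG : G.Preconnected) (hH : H.Preconnected)
    (hGP : ¬ Nonempty (G ≃g SimpleGraph.pathGraph 3))
    (hGC : ¬ Nonempty (G ≃g SimpleGraph.cycleGraph 4))
    (hHP : ¬ Nonempty (H ≃g SimpleGraph.pathGraph 3))
    (hHC : ¬ Nonempty (H ≃g SimpleGraph.cycleGraph 4))
    {dG dH : ℕ} (hdG : ∀ g, dG ≤ G.degree g) (hdH : ∀ h, dH ≤ H.degree h) (hG1 : 1 ≤ dG)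
    (hH1 : 1 ≤ dH) {f : α → β → Bool} (hT : total G H f ≤ 2 * (dG * dH)) :
    (∀ g, NbhdConst H (f g)) ∨ (∀ h, NbhdConst G (fun g => f g h)) ∨
      ∃ r k, ∀ x y, G.Adj x y → ∀ h h', H.Adj h h' →
        (f x h ^^ decide (x = r ∧ h = k)) = (f y h' ^^ decide (y = r ∧ h' = k)) := by
  by_contra! hno
  obtain ⟨⟨g, hg⟩, ⟨h, hh⟩, hflip⟩ := hno
  have hT' : total H G (fun h g => f g h) ≤ 2 * (dH * dG) := by
    rw [← total_swap, mul_comm dH]; exact hT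
  by_cases hheavy : ∀ g g', G.Adj g g' → ¬ NbhdConst H (f g) → dH ≤ disagree H (f g) (f g')
  · obtain ⟨k, hk⟩ := exists_flip_of_heavy hG hH hHP hHC hdG hdH hG1 hH1 hT hheavy hg hh
    obtain ⟨x, y, hxy, a, b, hab, hne⟩ := hflip g k
    exact hne (hk x y hxy a b hab)
  by_cases hheavy' : ∀ h h', H.Adj h h' → ¬ NbhdConst G (fun g => f g h) →
      dG ≤ disagree G (fun g => f g h) (fun g => f g h')
  · obtain ⟨r, hr⟩ := exists_flip_of_heavy hH hG hGP hGC hdH hdG hH1 hG1 hT' hheavy' hh hg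
    obtain ⟨x, y, hxy, a, b, hab, hne⟩ := hflip r h
    refine hne ?_
    simpa only [and_comm] using hr a b hab x y hxy
  push Not at hheavy hheavy'
  obtain ⟨x, x', hx, hxb, hxl⟩ := hheavy
  obtain ⟨y, y', hy, hyb, hyl⟩ := hheavy'
  have := one_le_disagree hxb (f x')
  exact false_of_light_of_light hdG hdH hG1 hT
    (not_nbhdConst_of_light hG hdG hdH hG1 hT hx hxb hxl)
    (not_nbhdConst_of_light hH hdH hdG hH1 hT' hy hyb hyl)
    (two_mul_le_card_of_disagree_lt hdG hyb hyl) (two_mul_le_card_of_disagree_lt hdH hxb hxl)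
    (by omega)

end Counting

/-! ### The types of cuts with good layers -/

section Types

variable {α β : Type*}

/-- The fibres of a map to `Fin n` form a partition. -/
lemma isPartitionInto_fiber {n : ℕ} (c : α → Fin n) : IsPartitionInto fun i => {g | c g = i} := by
  refine ⟨fun i j hij => Set.disjoint_left.2 ?_, ?_⟩
  · rintro g rfl h
    exact hij h
  · ext g
    simp

lemma type_of_nbhdConst (G : SimpleGraph α) {H : SimpleGraph β} (hH : H.Preconnected)
    {f : α → β → Bool} (hf : ∀ g, NbhdConst H (f g)) {B W : Set (α × β)}
    (hB : ∀ p, p ∈ B ↔ f p.1 p.2 = true) (hW : ∀ p, p ∈ W ↔ f p.1 p.2 = false) :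
    Type1 B W ∨ Type4 G H B W ∨ Type5 H B W ∨ Type7 H B W := by
  by_cases hconst : ∀ g h h', f g h = f g h'
  · left
    refine ⟨{g | ∀ h, f g h = true}, {g | ∀ h, f g h = false}, ?_, ?_, ?_⟩
    · ext g
      simp only [Set.mem_union, Set.mem_ofPred_eq, Set.mem_univ, iff_true]
      by_contra! hno
      obtain ⟨⟨h, hh⟩, ⟨h', hh'⟩⟩ := hno
      have := hconst g h h'
      simp_all
    · ext ⟨g, h⟩
      simp only [hB, Set.mem_prod, Set.mem_ofPred_eq, Set.mem_univ, and_true]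
      exact ⟨fun hh h' => (hconst g h' h).trans hh, fun hh => hh h⟩
    · ext ⟨g, h⟩
      simp only [hW, Set.mem_prod, Set.mem_ofPred_eq, Set.mem_univ, and_true]
      exact ⟨fun hh h' => (hconst g h' h).trans hh, fun hh => hh h⟩
  right
  push Not at hconst
  obtain ⟨g₀, h₀, h₀', hne⟩ := hconst
  have hproper : ∀ h h', H.Adj h h' → f g₀ h ≠ f g₀ h' :=
    ((hf g₀).const_or_proper hH).resolve_left fun h => hne (h _ _)
  have hbip : IsBipartition H {h | f g₀ h = true} {h | f g₀ h = false} := by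
    have hdisj : Disjoint {h | f g₀ h = true} {h | f g₀ h = false} :=
      Set.disjoint_left.2 fun h h1 h2 => by simp_all
    refine ⟨⟨hdisj, codisjoint_iff.2 ?_⟩, ⟨hdisj, fun h h' hh => ?_⟩⟩
    · ext h
      cases hh : f g₀ h <;> simp [hh]
    · have := hproper h h' hh
      cases hh : f g₀ h <;> cases hh' : f g₀ h' <;> simp_all
  -- A proper colouring of a connected graph is unique up to exchanging the colours, so a layer is
  -- `f g₀` (class 0), its complement (class 1), black (class 2) or white (class 3).
  have hclass : ∀ g, ∃ i : Fin 4, (i = 0 ∧ ∀ h, f g h = f g₀ h) ∨ (i = 1 ∧ ∀ h, f g h = !f g₀ h) ∨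
      (i = 2 ∧ ∀ h, f g h = true) ∨ (i = 3 ∧ ∀ h, f g h = false) := by
    intro g
    rcases (hf g).const_or_proper hH with hc | hp
    · cases hv : f g h₀
      · exact ⟨3, by simpa using fun h => (hc h h₀).trans hv⟩
      · exact ⟨2, by simpa using fun h => (hc h h₀).trans hv⟩
    · have hx := eq_of_adj_eq hH (a := fun h => f g h ^^ f g₀ h) fun h h' hh => by
        have h1 := hp h h' hh
        have h2 := hproper h h' hh
        revert h1 h2
        cases f g h <;> cases f g h' <;> cases f g₀ h <;> cases f g₀ h' <;> simp
      cases hv : (f g h₀ ^^ f g₀ h₀)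
      · exact ⟨0, by simpa using fun h => by simpa [hv] using hx h h₀⟩
      · exact ⟨1, by simpa using fun h => Bool.eq_not.2 (by simpa [hv] using hx h h₀)⟩
  choose c hc using hclass
  have hc₀ : c g₀ = 0 ∨ c g₀ = 1 := by
    rcases hc g₀ with h | h | h | h
    · exact Or.inl h.1
    · exact Or.inr h.1
    · exact absurd ((h.2 h₀).trans (h.2 h₀').symm) hne
    · exact absurd ((h.2 h₀).trans (h.2 h₀').symm) hne
  by_cases h2 : ∃ g, c g = 2
  · by_cases h3 : ∃ g, c g = 3
    · refine Or.inr (Or.inr ⟨fun i => {g | c g = i}, _, _, isPartitionInto_fiber c, hbip,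
        ⟨g₀, hc₀⟩, h2, h3, ?_, ?_⟩)
      · ext ⟨g, h⟩
        rcases hc g with ⟨hi, hv⟩ | ⟨hi, hv⟩ | ⟨hi, hv⟩ | ⟨hi, hv⟩ <;> simp [hB, hi, hv]
      · ext ⟨g, h⟩
        rcases hc g with ⟨hi, hv⟩ | ⟨hi, hv⟩ | ⟨hi, hv⟩ | ⟨hi, hv⟩ <;> simp [hW, hi, hv]
    · have h3' : ∀ g, c g ≠ 3 := by simpa using h3
      refine Or.inr (Or.inl ⟨_, _, _, isPartitionInto_fiber
        (fun g => if c g = 1 then (0 : Fin 3) else if c g = 0 then 1 else 2), hbip,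
        ⟨g₀, ?_⟩, ?_, Or.inr ⟨?_, ?_⟩⟩)
      · rcases hc₀ with h | h <;> simp [h]
      · obtain ⟨g, hg⟩ := h2
        exact ⟨g, by simp [hg]⟩
      · ext ⟨g, h⟩
        rcases hc g with ⟨hi, hv⟩ | ⟨hi, hv⟩ | ⟨hi, hv⟩ | ⟨hi, hv⟩
        iterate 3 simp [hW, hi, hv]
        exact absurd hi (h3' g)
      · ext ⟨g, h⟩
        rcases hc g with ⟨hi, hv⟩ | ⟨hi, hv⟩ | ⟨hi, hv⟩ | ⟨hi, hv⟩
        iterate 3 simp [hB, hi, hv]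
        exact absurd hi (h3' g)
  · have h2' : ∀ g, c g ≠ 2 := by simpa using h2
    by_cases h3 : ∃ g, c g = 3
    · refine Or.inr (Or.inl ⟨_, _, _, isPartitionInto_fiber
        (fun g => if c g = 0 then (0 : Fin 3) else if c g = 1 then 1 else 2), hbip,
        ⟨g₀, ?_⟩, ?_, Or.inl ⟨?_, ?_⟩⟩)
      · rcases hc₀ with h | h <;> simp [h]
      · obtain ⟨g, hg⟩ := h3
        exact ⟨g, by simp [hg]⟩
      · ext ⟨g, h⟩
        rcases hc g with ⟨hi, hv⟩ | ⟨hi, hv⟩ | ⟨hi, hv⟩ | ⟨hi, hv⟩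
        iterate 2 simp [hB, hi, hv]
        · exact absurd hi (h2' g)
        · simp [hB, hi, hv]
      · ext ⟨g, h⟩
        rcases hc g with ⟨hi, hv⟩ | ⟨hi, hv⟩ | ⟨hi, hv⟩ | ⟨hi, hv⟩
        iterate 2 simp [hW, hi, hv]
        · exact absurd hi (h2' g)
        · simp [hW, hi, hv]
    · have h3' : ∀ g, c g ≠ 3 := by simpa using h3
      have hc' : ∀ g, (c g = 0 ∧ ∀ h, f g h = f g₀ h) ∨ (c g = 1 ∧ ∀ h, f g h = !f g₀ h) := by
        intro g
        have := hc g
        simp only [h2' g, h3' g, false_and, or_false] at this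
        exact this
      refine Or.inl ⟨{g | c g = 0}, {g | c g = 1}, _, _, ⟨?_, ?_⟩, hbip.1, Or.inr hbip, ?_, ?_⟩
      · exact (isPartitionInto_fiber c).1 (by decide)
      · refine codisjoint_iff.2 ?_
        ext g
        rcases hc' g with h | h <;> simp [h.1]
      · ext ⟨g, h⟩
        rcases hc' g with ⟨hi, hv⟩ | ⟨hi, hv⟩ <;> simp [hB, hi, hv]
      · ext ⟨g, h⟩
        rcases hc' g with ⟨hi, hv⟩ | ⟨hi, hv⟩ <;> simp [hW, hi, hv]

lemma preimage_swap_eq_iff {s : Set (α × β)} {t : Set (β × α)} :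
    Prod.swap ⁻¹' s = t ↔ s = Prod.swap ⁻¹' t := by
  constructor
  · rintro rfl
    ext ⟨x, y⟩; simp
  · rintro rfl
    ext ⟨x, y⟩; simp

lemma Type1.of_swap {B W : Set (α × β)} (h : Type1 (Prod.swap ⁻¹' B) (Prod.swap ⁻¹' W)) :
    Type2 B W := by
  obtain ⟨B', W', hu, h1, h2⟩ := h
  rw [preimage_swap_eq_iff] at h1 h2
  exact ⟨B', W', hu, by simpa using h1, by simpa using h2⟩

lemma Type4.of_swap {G : SimpleGraph α} {H : SimpleGraph β} {B W : Set (α × β)}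
    (h : Type4 H G (Prod.swap ⁻¹' B) (Prod.swap ⁻¹' W)) : Type4 G H B W := by
  obtain ⟨A₁, A₂, C, D, hA, hC, hbip, h1, h2⟩ := h
  rw [preimage_swap_eq_iff] at h1 h2
  exact ⟨C, D, A₁, A₂, hC, hA, hbip.symm, by simpa using h1,
    by simpa [Set.union_comm] using h2⟩

lemma Type5.of_swap {G : SimpleGraph α} {B W : Set (α × β)}
    (h : Type5 G (Prod.swap ⁻¹' B) (Prod.swap ⁻¹' W)) : Type6 G B W := by
  obtain ⟨A, C, D, hA, hbip, h0, h2, h⟩ := h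
  simp only [preimage_swap_eq_iff] at h
  exact ⟨A, C, D, hA, hbip, h0, h2, by simpa using h⟩

lemma Type7.of_swap {G : SimpleGraph α} {B W : Set (α × β)}
    (h : Type7 G (Prod.swap ⁻¹' B) (Prod.swap ⁻¹' W)) : Type8 G B W := by
  obtain ⟨A, C, D, hA, hbip, h0, h2, h3, hB, hW⟩ := h
  rw [preimage_swap_eq_iff] at hB hW
  exact ⟨A, C, D, hA, hbip, h0, h2, h3, by simpa using hB, by simpa using hW⟩

end Types

/-! ### Minimum edge-cuts and connected components -/

section Cuts
open scoped Classical
open Finset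

variable {V : Type*}

/-- The set of edges of `Γ` between `B` and its complement. -/
def cut (Γ : SimpleGraph V) (B : Set V) : Set (Sym2 V) :=
  {e | ∃ b ∈ B, ∃ w ∈ Bᶜ, Γ.Adj b w ∧ e = s(b, w)}

lemma isEdgeCut_cut (Γ : SimpleGraph V) {B : Set V} (hB : B.Nonempty) (hW : Bᶜ.Nonempty) :
    IsEdgeCut Γ (cut Γ B) := by
  constructor
  · rintro _ ⟨b, -, w, -, hbw, rfl⟩
    exact hbw
  · intro hcon
    obtain ⟨b, hb⟩ := hB
    obtain ⟨w, hw⟩ := hW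
    have := eq_of_adj_eq hcon (a := fun v => v ∈ B) (fun x y hxy => ?_) b w
    · exact hw (this ▸ hb)
    · rw [SimpleGraph.deleteEdges_adj] at hxy
      by_contra hne
      refine hxy.2 ?_
      by_cases hx : x ∈ B
      · exact ⟨x, hx, y, fun hy => hne (by simp [hx, hy]), hxy.1, rfl⟩
      · exact ⟨y, by by_contra hy; exact hne (by simp [hx, hy]), x, hx, hxy.1.symm,
          Sym2.eq_swap⟩

lemma IsMinEdgeCut.eq_cut [Finite V] {Γ : SimpleGraph V} {S : Set (Sym2 V)}
    (hS : IsMinEdgeCut Γ S) {B : Set V} (hB : B.Nonempty) (hW : Bᶜ.Nonempty)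
    (hsub : cut Γ B ⊆ S) : cut Γ B = S :=
  Set.eq_of_subset_of_ncard_le hsub (hS.2 _ (isEdgeCut_cut Γ hB hW)) (Set.toFinite _)

lemma cut_supp_subset {Γ : SimpleGraph V} {S : Set (Sym2 V)}
    (K : (Γ.deleteEdges S).ConnectedComponent) : cut Γ K.supp ⊆ S := by
  rintro _ ⟨b, hb, w, hw, hbw, rfl⟩
  by_contra hS
  refine hw ?_
  have : (Γ.deleteEdges S).Adj b w := by simp [SimpleGraph.deleteEdges_adj, hbw, hS]
  exact (K.mem_supp_congr_adj this).1 hb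

lemma IsMinEdgeCut.exists_eq_cut [Finite V] {Γ : SimpleGraph V} {S : Set (Sym2 V)}
    (hS : IsMinEdgeCut Γ S) : ∃ B : Set V, B.Nonempty ∧ Bᶜ.Nonempty ∧ cut Γ B = S := by
  have h := hS.1.2
  simp only [SimpleGraph.Preconnected, not_forall] at h
  obtain ⟨x, y, hxy⟩ := h
  set K := (Γ.deleteEdges S).connectedComponentMk x
  have hB : K.supp.Nonempty := ⟨x, rfl⟩
  have hW : K.suppᶜ.Nonempty :=
    ⟨y, fun hy => hxy (SimpleGraph.ConnectedComponent.exact hy).symm⟩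
  exact ⟨K.supp, hB, hW, hS.eq_cut hB hW (cut_supp_subset K)⟩

lemma IsMinEdgeCut.eq_empty_of_isEdgeCut_empty [Finite V] {Γ : SimpleGraph V} {S : Set (Sym2 V)}
    (hS : IsMinEdgeCut Γ S) (h : IsEdgeCut Γ ∅) : S = ∅ := by
  have h := hS.2 ∅ h
  rwa [Set.ncard_empty, Nat.le_zero, Set.ncard_eq_zero (Set.toFinite _)] at h

/-- If the graph has at most two components, either side of a minimum edge-cut is connected.
Otherwise the edges leaving a component `K` inside `B` and the edges leaving `B \ K` are both
edge-cuts contained in `cut Γ B`, hence equal to it; but no edge leaves both sets for `Bᶜ`. So the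
cut is empty and `Γ` has three components. -/
lemma IsMinEdgeCut.reachable_of_mem [Finite V] {Γ : SimpleGraph V}
    (hcard : Nat.card Γ.ConnectedComponent ≤ 2) {B : Set V} (hW : Bᶜ.Nonempty)
    (hS : IsMinEdgeCut Γ (cut Γ B)) {x y : V} (hx : x ∈ B) (hy : y ∈ B) :
    (Γ.deleteEdges (cut Γ B)).Reachable x y := by
  by_contra hxy
  obtain ⟨w, hw⟩ := hW
  have hout : ∀ b ∈ B, ∀ z, (Γ.deleteEdges (cut Γ B)).Reachable b z → z ∈ B := by
    rintro b hb z ⟨p⟩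
    induction p with
    | nil => exact hb
    | @cons u v _ huv _ ih =>
      refine ih ?_
      by_contra hv
      rw [SimpleGraph.deleteEdges_adj] at huv
      exact huv.2 ⟨u, hb, v, hv, huv.1, rfl⟩
  set K := (Γ.deleteEdges (cut Γ B)).connectedComponentMk x with hK
  have hmem : ∀ z, z ∈ K.supp ↔ (Γ.deleteEdges (cut Γ B)).Reachable x z := fun z =>
    ⟨fun h => (SimpleGraph.ConnectedComponent.exact h).symm,
      fun h => (SimpleGraph.ConnectedComponent.sound h).symm⟩
  have hKB : K.supp ⊆ B := fun z hz => hout x hx z ((hmem z).1 hz)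
  have hyK : y ∉ K.supp := fun h => hxy ((hmem y).1 h)
  have hcut₁ : cut Γ K.supp = cut Γ B :=
    hS.eq_cut ⟨x, rfl⟩ ⟨y, hyK⟩ (cut_supp_subset K)
  have hcut₂ : cut Γ (B \ K.supp) = cut Γ B := by
    refine hS.eq_cut ⟨y, hy, hyK⟩ ⟨w, fun h => hw h.1⟩ ?_
    rintro _ ⟨b, hb, v, hv, hbv, rfl⟩
    by_cases hvB : v ∈ B
    · have hvK : v ∈ K.supp := by
        by_contra h
        exact hv ⟨hvB, h⟩
      exact cut_supp_subset K ⟨v, hvK, b, hb.2, hbv.symm, Sym2.eq_swap⟩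
    · exact ⟨b, hb.1, v, hvB, hbv, rfl⟩
  have hempty : cut Γ B = ∅ := by
    rw [Set.eq_empty_iff_forall_notMem]
    intro e he
    obtain ⟨b, hb, v, hv, -, rfl⟩ := id he
    obtain ⟨b₁, hb₁, v₁, hv₁, -, h₁⟩ := hcut₁.symm ▸ he
    obtain ⟨b₂, hb₂, v₂, hv₂, -, h₂⟩ := hcut₂.symm ▸ he
    rw [Sym2.eq_iff] at h₁ h₂
    rcases h₁ with ⟨rfl, rfl⟩ | ⟨rfl, rfl⟩
    · rcases h₂ with ⟨rfl, rfl⟩ | ⟨rfl, rfl⟩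
      exacts [hb₂.2 hb₁, hv hb₂.1]
    · exact hv (hKB hb₁)
  rw [hempty] at hxy hout
  rw [SimpleGraph.deleteEdges_empty] at hxy hout
  have hxw : ¬ Γ.Reachable x w := fun h => hw (hout x hx w h)
  have hyw : ¬ Γ.Reachable y w := fun h => hw (hout y hy w h)
  have : Function.Injective ![Γ.connectedComponentMk x, Γ.connectedComponentMk y,
      Γ.connectedComponentMk w] := by
    intro i j hij
    fin_cases i <;> fin_cases j <;>
      simp_all [SimpleGraph.ConnectedComponent.eq, SimpleGraph.reachable_comm]
  have := Nat.card_le_card_of_injective _ this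
  simp at this
  omega

lemma cut_compl (Γ : SimpleGraph V) (B : Set V) : cut Γ Bᶜ = cut Γ B := by
  ext e
  constructor
  · rintro ⟨b, hb, w, hw, h, rfl⟩
    exact ⟨w, not_not.1 hw, b, hb, h.symm, Sym2.eq_swap⟩
  · rintro ⟨b, hb, w, hw, h, rfl⟩
    exact ⟨w, hw, b, not_not.2 hb, h.symm, Sym2.eq_swap⟩

lemma IsMinEdgeCut.areTheComponents [Finite V] {Γ : SimpleGraph V}
    (hcard : Nat.card Γ.ConnectedComponent ≤ 2) {B : Set V} (hB : B.Nonempty) (hW : Bᶜ.Nonempty)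
    (hS : IsMinEdgeCut Γ (cut Γ B)) : AreTheComponents (Γ.deleteEdges (cut Γ B)) B Bᶜ := by
  set Δ := Γ.deleteEdges (cut Γ B) with hΔ
  have hside : ∀ x y, Δ.Adj x y → (x ∈ B) = (y ∈ B) := by
    intro x y hxy
    rw [hΔ, SimpleGraph.deleteEdges_adj] at hxy
    by_contra hne
    refine hxy.2 ?_
    by_cases hx : x ∈ B
    · exact ⟨x, hx, y, fun hy => hne (by simp [hx, hy]), hxy.1, rfl⟩
    · exact ⟨y, by by_contra hy; exact hne (by simp [hx, hy]), x, hx, hxy.1.symm, Sym2.eq_swap⟩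
  have hside' : ∀ x y, Δ.Reachable x y → (x ∈ B ↔ y ∈ B) := by
    rintro x y ⟨p⟩
    induction p with
    | nil => rfl
    | cons hxy _ ih => rw [← ih, hside _ _ hxy]
  have hsupp : ∀ x, (Δ.connectedComponentMk x).supp = {z | Δ.Reachable x z} := fun x => by
    ext z
    simp [SimpleGraph.ConnectedComponent.eq, SimpleGraph.reachable_comm]
  have hBx : ∀ x ∈ B, (Δ.connectedComponentMk x).supp = B := by
    intro x hx
    rw [hsupp]
    ext z
    exact ⟨fun h => (hside' x z h).1 hx, fun hz => hS.reachable_of_mem hcard hW hx hz⟩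
  have hWx : ∀ x ∉ B, (Δ.connectedComponentMk x).supp = Bᶜ := by
    intro x hx
    rw [hsupp]
    ext z
    refine ⟨fun h hz => hx ((hside' x z h).2 hz), fun hz => ?_⟩
    have hS' := hS
    rw [← cut_compl] at hS'
    have := hS'.reachable_of_mem hcard (by simpa using hB) (x := x) (y := z) hx hz
    rwa [cut_compl] at this
  refine ⟨fun h => ?_, ?_⟩
  · obtain ⟨x, hx⟩ := hB
    exact (h ▸ hx : x ∈ Bᶜ) hx
  · ext T
    constructor
    · rintro ⟨c, rfl⟩
      induction c using SimpleGraph.ConnectedComponent.ind with | h x => ?_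
      by_cases hx : x ∈ B
      · exact Or.inl (hBx x hx)
      · exact Or.inr (hWx x hx)
    · rintro (rfl | rfl)
      · obtain ⟨x, hx⟩ := hB
        exact ⟨_, hBx x hx⟩
      · obtain ⟨x, hx⟩ := hW
        exact ⟨_, hWx x hx⟩

lemma two_mul_ncard_cut [Fintype V] (Γ : SimpleGraph V) (F : V → Bool) :
    2 * (cut Γ {v | F v = true}).ncard = disagree Γ F F := by
  rw [disagree_eq_add, ← two_mul, sum_card_filter_neighborFinset]
  congr 1
  have h1 : cut Γ {v | F v = true} = (fun p : V × V => s(p.1, p.2)) ''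
      ↑({p : V × V | Γ.Adj p.1 p.2 ∧ F p.1 = true ∧ F p.2 = false} : Finset (V × V)) := by
    ext e
    simp only [cut, Set.mem_ofPred_eq, Set.mem_compl_iff, Bool.not_eq_true, Set.mem_image,
      coe_filter, mem_univ, true_and, Prod.exists]
    constructor
    · rintro ⟨b, hb, w, hw, h, rfl⟩
      exact ⟨b, w, ⟨h, hb, hw⟩, rfl⟩
    · rintro ⟨b, w, ⟨h, hb, hw⟩, rfl⟩
      exact ⟨b, hb, w, hw, h, rfl⟩
  rw [h1, Set.InjOn.ncard_image, Set.ncard_coe_finset, card_filter, Fintype.sum_prod_type]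
  rintro ⟨b, w⟩ hp ⟨b', w'⟩ hp' h
  simp only [coe_filter, mem_univ, true_and, Set.mem_ofPred_eq] at hp hp'
  rcases Sym2.eq_iff.1 h with ⟨rfl, rfl⟩ | ⟨rfl, rfl⟩
  · rfl
  · simp_all

lemma ncard_cut_singleton_le [Fintype V] (Γ : SimpleGraph V) (v : V) :
    (cut Γ {v}).ncard ≤ Γ.degree v := by
  have h : cut Γ {v} ⊆ (fun w => s(v, w)) '' ↑(Γ.neighborFinset v) := by
    rintro _ ⟨b, rfl, w, -, h, rfl⟩
    exact ⟨w, by simpa using h, rfl⟩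
  refine (Set.ncard_le_ncard h (Set.toFinite _)).trans ?_
  refine (Set.ncard_image_le (Set.toFinite _)).trans ?_
  rw [Set.ncard_coe_finset, SimpleGraph.card_neighborFinset_eq_degree]

variable {α β : Type*} [Fintype α] [Fintype β]

lemma degree_directProd (G : SimpleGraph α) (H : SimpleGraph β) (p : α × β) :
    (directProd G H).degree p = G.degree p.1 * H.degree p.2 := by
  simp only [← SimpleGraph.card_neighborFinset_eq_degree]
  rw [← card_product]
  congr 1
  ext q
  simp only [SimpleGraph.mem_neighborFinset, mem_product]
  rfl

lemma disagree_directProd (G : SimpleGraph α) (H : SimpleGraph β) (f : α → β → Bool) :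
    disagree (directProd G H) (fun p => f p.1 p.2) (fun p => f p.1 p.2) = total G H f := by
  simp only [disagree, total, Fintype.sum_prod_type]
  refine sum_congr rfl fun g _ => ?_
  rw [sum_comm]
  refine sum_congr rfl fun g' _ => ?_
  split_ifs with h <;> simp [directProd, h]

end Cuts

/-! ### Minimum edge-cuts of direct products -/

section Main
open scoped Classical

variable {α β : Type*}

lemma type_of_nbhdConst_left {G : SimpleGraph α} {H : SimpleGraph β}
    (hG : G.Preconnected) {f : α → β → Bool} (hf : ∀ h, NbhdConst G (fun g => f g h))
    {B W : Set (α × β)} (hB : ∀ p, p ∈ B ↔ f p.1 p.2 = true)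
    (hW : ∀ p, p ∈ W ↔ f p.1 p.2 = false) :
    Type2 B W ∨ Type4 G H B W ∨ Type6 G B W ∨ Type8 G B W := by
  rcases type_of_nbhdConst H hG (f := fun h g => f g h) (B := Prod.swap ⁻¹' B)
    (W := Prod.swap ⁻¹' W) hf (fun p => hB p.swap) (fun p => hW p.swap) with h | h | h | h
  exacts [Or.inl h.of_swap, Or.inr (Or.inl h.of_swap), Or.inr (Or.inr (Or.inl h.of_swap)),
    Or.inr (Or.inr (Or.inr h.of_swap))]

lemma nbhdConst_of_subsingleton [Subsingleton β] (H : SimpleGraph β) (a : β → Bool) :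
    NbhdConst H a :=
  ⟨a, fun h h' hh => absurd (Subsingleton.elim h h') hh.ne⟩

lemma IsMinEdgeCut.exists_eq_cut_type1_of_not_preconnected [Finite α] [Finite β] {G : SimpleGraph α}
    {H : SimpleGraph β} {S : Set (Sym2 (α × β))} (hS : IsMinEdgeCut (directProd G H) S)
    [Nonempty β] (hG : ¬ G.Preconnected) :
    ∃ B : Set (α × β), B.Nonempty ∧ Bᶜ.Nonempty ∧ cut (directProd G H) B = S ∧ Type1 B Bᶜ := by
  simp only [SimpleGraph.Preconnected, not_forall] at hG
  obtain ⟨x, y, hxy⟩ := hG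
  obtain ⟨h⟩ := ‹Nonempty β›
  set K := (G.connectedComponentMk x).supp with hK
  have hy : y ∉ K := fun hy => hxy (SimpleGraph.ConnectedComponent.exact hy).symm
  have hB : (K ×ˢ (Set.univ : Set β)).Nonempty := ⟨(x, h), rfl, trivial⟩
  have hW : (K ×ˢ (Set.univ : Set β))ᶜ.Nonempty := ⟨(y, h), fun hm => hy hm.1⟩
  have hcut : cut (directProd G H) (K ×ˢ Set.univ) = ∅ := by
    rw [Set.eq_empty_iff_forall_notMem]
    rintro _ ⟨b, hb, w, hw, hbw, rfl⟩
    exact hw ⟨((G.connectedComponentMk x).mem_supp_congr_adj hbw.1).1 hb.1, trivial⟩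
  refine ⟨K ×ˢ Set.univ, hB, hW, ?_, K, Kᶜ, Set.union_compl_self K, rfl, ?_⟩
  · rw [hcut, hS.eq_empty_of_isEdgeCut_empty (hcut ▸ isEdgeCut_cut _ hB hW)]
  · ext ⟨a, b⟩
    simp

lemma IsMinEdgeCut.exists_eq_cut_type2_of_not_preconnected [Finite α] [Finite β] {G : SimpleGraph α}
    {H : SimpleGraph β} {S : Set (Sym2 (α × β))} (hS : IsMinEdgeCut (directProd G H) S)
    [Nonempty α] (hH : ¬ H.Preconnected) :
    ∃ B : Set (α × β), B.Nonempty ∧ Bᶜ.Nonempty ∧ cut (directProd G H) B = S ∧ Type2 B Bᶜ := by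
  simp only [SimpleGraph.Preconnected, not_forall] at hH
  obtain ⟨x, y, hxy⟩ := hH
  obtain ⟨g⟩ := ‹Nonempty α›
  set K := (H.connectedComponentMk x).supp with hK
  have hy : y ∉ K := fun hy => hxy (SimpleGraph.ConnectedComponent.exact hy).symm
  have hB : ((Set.univ : Set α) ×ˢ K).Nonempty := ⟨(g, x), trivial, rfl⟩
  have hW : ((Set.univ : Set α) ×ˢ K)ᶜ.Nonempty := ⟨(g, y), fun hm => hy hm.2⟩
  have hcut : cut (directProd G H) (Set.univ ×ˢ K) = ∅ := by
    rw [Set.eq_empty_iff_forall_notMem]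
    rintro _ ⟨b, hb, w, hw, hbw, rfl⟩
    exact hw ⟨trivial, ((H.connectedComponentMk x).mem_supp_congr_adj hbw.2).1 hb.2⟩
  refine ⟨Set.univ ×ˢ K, hB, hW, ?_, K, Kᶜ, Set.union_compl_self K, rfl, ?_⟩
  · rw [hcut, hS.eq_empty_of_isEdgeCut_empty (hcut ▸ isEdgeCut_cut _ hB hW)]
  · ext ⟨a, b⟩
    simp

lemma IsMinEdgeCut.ncard_le_minDegree_mul [Fintype α] [Fintype β] [Nontrivial α] [Nonempty β]
    {G : SimpleGraph α} {H : SimpleGraph β} {S : Set (Sym2 (α × β))}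
    (hS : IsMinEdgeCut (directProd G H) S) : S.ncard ≤ G.minDegree * H.minDegree := by
  obtain ⟨g, hg⟩ := G.exists_minimal_degree_vertex
  obtain ⟨h, hh⟩ := H.exists_minimal_degree_vertex
  obtain ⟨g', hg'⟩ := exists_ne g
  refine (hS.2 _ (isEdgeCut_cut _ (Set.singleton_nonempty (g, h))
    ⟨(g', h), by simpa using hg'⟩)).trans ?_
  refine (ncard_cut_singleton_le _ _).trans ?_
  rw [degree_directProd, hg, hh]

/-- If both factors are connected, every colouring that defines the minimum edge-cut has one of the
eight types. -/
lemma type_of_isMinEdgeCut [Fintype α] [Fintype β] {G : SimpleGraph α} {H : SimpleGraph β}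
    (hGP : ¬ Nonempty (G ≃g SimpleGraph.pathGraph 3))
    (hGC : ¬ Nonempty (G ≃g SimpleGraph.cycleGraph 4))
    (hHP : ¬ Nonempty (H ≃g SimpleGraph.pathGraph 3))
    (hHC : ¬ Nonempty (H ≃g SimpleGraph.cycleGraph 4))
    (hG : G.Preconnected) (hH : H.Preconnected) {B : Set (α × β)}
    (hS : IsMinEdgeCut (directProd G H) (cut (directProd G H) B)) :
    Type1 B Bᶜ ∨ Type2 B Bᶜ ∨ Type3 B Bᶜ ∨ Type4 G H B Bᶜ ∨ Type5 H B Bᶜ ∨ Type6 G B Bᶜ ∨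
      Type7 H B Bᶜ ∨ Type8 G B Bᶜ := by
  set f : α → β → Bool := fun g h => decide ((g, h) ∈ B) with hf
  have hfB : ∀ p, p ∈ B ↔ f p.1 p.2 = true := by simp [hf]
  have hfW : ∀ p, p ∈ Bᶜ ↔ f p.1 p.2 = false := by simp [hf]
  have right (h : ∀ g, NbhdConst H (f g)) : Type1 B Bᶜ ∨ Type2 B Bᶜ ∨ Type3 B Bᶜ ∨
      Type4 G H B Bᶜ ∨ Type5 H B Bᶜ ∨ Type6 G B Bᶜ ∨ Type7 H B Bᶜ ∨ Type8 G B Bᶜ := by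
    rcases type_of_nbhdConst G hH h hfB hfW with h | h | h | h <;>
      simp only [h, true_or, or_true]
  have left (h : ∀ h, NbhdConst G (fun g => f g h)) : Type1 B Bᶜ ∨ Type2 B Bᶜ ∨ Type3 B Bᶜ ∨
      Type4 G H B Bᶜ ∨ Type5 H B Bᶜ ∨ Type6 G B Bᶜ ∨ Type7 H B Bᶜ ∨ Type8 G B Bᶜ := by
    rcases type_of_nbhdConst_left (H := H) hG h hfB hfW with h | h | h | h <;>
      simp only [h, true_or, or_true]
  cases subsingleton_or_nontrivial α
  · exact left fun _ => nbhdConst_of_subsingleton G _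
  cases subsingleton_or_nontrivial β
  · exact right fun _ => nbhdConst_of_subsingleton H _
  have htotal : 2 * (cut (directProd G H) B).ncard = total G H f := by
    rw [← disagree_directProd, ← two_mul_ncard_cut]
    congr 3
    ext p
    exact hfB p
  have hT : total G H f ≤ 2 * (G.minDegree * H.minDegree) := by
    rw [← htotal]
    exact Nat.mul_le_mul_left 2 hS.ncard_le_minDegree_mul
  rcases layers_nbhdConst_or_exists_flip hG hH hGP hGC hHP hHC G.minDegree_le_degree
    H.minDegree_le_degree hG.minDegree_pos_of_nontrivial hH.minDegree_pos_of_nontrivial hT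
    with h | h | ⟨r, k, hrk⟩
  · exact right h
  · exact left h
  by_cases hΓ : (directProd G H).Preconnected
  · have hconst := eq_of_adj_eq hΓ (a := fun p => f p.1 p.2 ^^ decide (p.1 = r ∧ p.2 = k))
      fun p q hpq => hrk p.1 q.1 hpq.1 p.2 q.2 hpq.2
    refine Or.inr (Or.inr (Or.inl ?_))
    have hcase : (∀ p : α × β, f p.1 p.2 = decide (p.1 = r ∧ p.2 = k)) ∨
        (∀ p : α × β, f p.1 p.2 = !decide (p.1 = r ∧ p.2 = k)) := by
      cases hv : (f r k ^^ true)
      · exact Or.inl fun p => by simpa [hv] using hconst p (r, k)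
      · exact Or.inr fun p => Bool.eq_not.2 (by simpa [hv] using hconst p (r, k))
    rcases hcase with h | h
    · left
      rw [Set.ncard_eq_one]
      refine ⟨(r, k), Set.ext fun p => ?_⟩
      simp [hfB, h, Prod.ext_iff]
    · right
      rw [Set.ncard_eq_one]
      refine ⟨(r, k), Set.ext fun p => ?_⟩
      simp [hfW, h, Prod.ext_iff]
  -- a disconnected product has the empty minimum edge-cut, and then all layers are good
  · have hempty := hS.eq_empty_of_isEdgeCut_empty ⟨Set.empty_subset _, by simpa using hΓ⟩
    rw [hempty, Set.ncard_empty, mul_zero] at htotal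
    refine right fun g => ?_
    obtain ⟨g', hg'⟩ : (G.neighborFinset g).Nonempty := by
      rw [← Finset.card_pos, SimpleGraph.card_neighborFinset_eq_degree]
      exact hG.minDegree_pos_of_nontrivial.trans_le (G.minDegree_le_degree g)
    rw [total_eq_sum_neighborFinset] at htotal
    have h0 := Finset.sum_eq_zero_iff.1
      (Finset.sum_eq_zero_iff.1 htotal.symm g (Finset.mem_univ g)) g' hg'
    exact ⟨f g', fun h h' hh => disagree_eq_zero.1 h0 h h' hh⟩

end Main

end DirectProductCuts

theorem theorem1p2 {α β : Type*} [Finite α] [Finite β]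
    (G : SimpleGraph α) (H : SimpleGraph β)
    (hGP : ¬ Nonempty (G ≃g SimpleGraph.pathGraph 3))
    (hGC : ¬ Nonempty (G ≃g SimpleGraph.cycleGraph 4))
    (hHP : ¬ Nonempty (H ≃g SimpleGraph.pathGraph 3))
    (hHC : ¬ Nonempty (H ≃g SimpleGraph.cycleGraph 4))
    (S : Set (Sym2 (α × β)))
    (hS : DirectProductCuts.IsMinEdgeCut (DirectProductCuts.directProd G H) S) :
    ∃ B W : Set (α × β),
      DirectProductCuts.IsBlackWhite (DirectProductCuts.directProd G H) S B W ∧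
      (Nat.card (DirectProductCuts.directProd G H).ConnectedComponent ≤ 2 →
        DirectProductCuts.AreTheComponents
          ((DirectProductCuts.directProd G H).deleteEdges S) B W) ∧
      (DirectProductCuts.Type1 B W ∨
        DirectProductCuts.Type2 B W ∨
        DirectProductCuts.Type3 B W ∨
        DirectProductCuts.Type4 G H B W ∨
        DirectProductCuts.Type5 H B W ∨
        DirectProductCuts.Type6 G B W ∨
        DirectProductCuts.Type7 H B W ∨
        DirectProductCuts.Type8 G B W) := by

  open DirectProductCuts in
  have := Fintype.ofFinite α
  have := Fintype.ofFinite β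
  suffices h : ∃ B : Set (α × β), B.Nonempty ∧ Bᶜ.Nonempty ∧ cut (directProd G H) B = S ∧
      (Type1 B Bᶜ ∨ Type2 B Bᶜ ∨ Type3 B Bᶜ ∨ Type4 G H B Bᶜ ∨ Type5 H B Bᶜ ∨ Type6 G B Bᶜ ∨
        Type7 H B Bᶜ ∨ Type8 G B Bᶜ) by
    obtain ⟨B, hB, hW, rfl, h⟩ := h
    exact ⟨B, Bᶜ, ⟨hB, hW, isCompl_compl, rfl⟩, fun hcard => hS.areTheComponents hcard hB hW, h⟩
  obtain ⟨B, hB, hW, hcut⟩ := hS.exists_eq_cut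
  have : Nonempty α := ⟨hB.some.1⟩
  have : Nonempty β := ⟨hB.some.2⟩
  -- if a factor is disconnected, `S` is empty and the colouring has to be chosen along the
  -- components of that factor
  by_cases hG : G.Preconnected
  · by_cases hH : H.Preconnected
    · subst hcut
      exact ⟨B, hB, hW, rfl, type_of_isMinEdgeCut hGP hGC hHP hHC hG hH hS⟩
    · obtain ⟨B, hB, hW, hcut, h⟩ := hS.exists_eq_cut_type2_of_not_preconnected hH
      exact ⟨B, hB, hW, hcut, Or.inr (Or.inl h)⟩
  · obtain ⟨B, hB, hW, hcut, h⟩ := hS.exists_eq_cut_type1_of_not_preconnected hG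
    exact ⟨B, hB, hW, hcut, Or.inl h⟩
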